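/- **Conventions.** A $d$-dimensional formal group law over a commutative ring $A$ is a $d$-tuple $F\in A[[X,Y]]^d$, $X=(x_1,\dots,x_d)$, $Y=(y_1,\dots,y_d)$, with $F(X,0)=X$, $F(X,F(Y,Z))=F(F(X,Y),Z)$ and $F(X,Y)=F(Y,X)$. For formal group laws $F,F'$ of dimensions $d,d'$, $\mathrm{Hom}_A(F,F')$ is the set of $f\in A[[X]]^{d'}$ with $f(0)=0$ and $f(F(X,Y))=F'(f(X),f(Y))$; the linear coefficient of $f$ is the matrix $D\in M_{d',d}(A)$ with $f(X)\equiv DX \bmod \deg 2$. An action of a group $\mathcal G$ on $\Phi$ is a homomorphism $\mathcal G\to \mathrm{Aut}_A(\Phi)$. If $F$ is a formal group law over $A$ and $f\in\mathrm{Hom}_A(F,\Phi)$, the pair $(F,f)$ is fixed if $\sigma\circ f=f$ for all $\sigma\in\mathcal G$; a fixed pair $(F,f)$ is universal if for every fixed pair $(F',f')$ (with $F'$ over $A$ of any dimension) there is a unique $g\in\mathrm{Hom}_A(F',F)$ with $f'=f\circ g$. The logarithm of a $d$-dimensional formal group law $F$ over $\mathbb Z$ is the unique $\lambda\in\mathbb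 Q[[X]]^d$ with $\lambda(X)\equiv X\bmod\deg 2$ and $\lambda(F(X,Y))=\lambda(X)+\lambda(Y)$. For a prime $p$ let $\mathcal E_p=\mathbb Z_p[[\blacktriangle_p]]$ act on power series over $\mathbb Q_p$ without constant term by $\left(\sum_n a_n\blacktriangle_p^n\right)g=\sum_n a_n\,g(x_1^{p^n},\dots,x_d^{p^n})$, and let $M_d(\mathcal E_p)$ act accordingly on $d$-tuples of such power series. The logarithm $\lambda$ is said to be of $p$-type $u\in M_d(\mathcal E_p)$ if $u\equiv pI_d\bmod\blacktriangle_p$ and all coefficients of $u\lambda$ lie in $p\mathbb Z_p$. For $e\le r$ let $I_{r,e}=\begin{pmatrix}I_e\\0\end{pmatrix}\in M_{r,e}(\mathbb Z)$. **Statement.** Let $\Phi$ be an $r$-dimensional formal group law over $\mathbb Z$ with logarithm $\Lambda$, provided with an action of a group $\mathcal G$, and for every prime $p$ let $\Lambda$ be of $p$-type $v_p\in M_r(\mathcal E_p)$. For every prime $p$ put $$\mathcal G^*_p=\{D\in M_r(\mathbb Z_p):\ \Lambda^{-1}\circ(D+I_r)\Lambda \text{ is the automorphism given by some element of } \mathcal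 G\}.$$ Let $0\le e\le r$, $Q\in \mathrm{GL}_r(\mathbb Z)$ and let $F$ be an $e$-dimensional formal group law over $\mathbb Z$ such that for every prime $p$: 1. for every $D\in\mathcal G^*_p$, $$Q^{-1}DQ=\begin{pmatrix}0&\hat D\\0&\tilde D\end{pmatrix},\qquad \hat D\in M_{e,r-e}(\mathbb Z_p),\quad \tilde D\in M_{r-e}(\mathbb Z_p);$$ 2. there are $m\geq 0$, $D_1,\dots,D_m\in\mathcal G^*_p$, $\hat C_i\in M_{r-e,e}(\mathbb Z_p)$ and $\tilde C_i\in M_{r-e}(\mathbb Z_p)$ $(1\le i\le m)$ such that $\sum_{i=1}^m(\hat C_i\hat D_i+\tilde C_i\tilde D_i)\in \mathrm{GL}_{r-e}(\mathbb Z_p)$; 3. the logarithm of $F$ is of $p$-type $u_p$, where $u_p$ is the upper-left $e\times e$-submatrix of $Q^{-1}v_pQ$. Then there exists $f\in\mathrm{Hom}_{\mathbb Z}(F,\Phi)$ whose linear coefficient is $QI_{r,e}$ and such that $(F,f)$ is a universal fixed pair for $(\Phi,\mathcal G)$ over $\mathbb Z$. -/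

import Mathlib

noncomputable section

/-- Composition `g ∘ f` of tuples of power series: substitute the tuple `f` into each entry
of `g`. -/
def seriesComp {κ σ τ A : Type*} [CommRing A] (g : κ → MvPowerSeries σ A)
    (f : σ → MvPowerSeries τ A) : κ → MvPowerSeries τ A :=
  fun i => (g i).subst f

/-- Base change of a tuple of power series along a ring homomorphism of the coefficients. -/
def seriesMap {κ σ A B : Type*} [CommRing A] [CommRing B] (φ : A →+* B)
    (g : κ → MvPowerSeries σ A) : κ → MvPowerSeries σ B :=
  fun i => (g i).map φ

/-- The product `D g` of a matrix of constants with a column of power series. -/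
def matrixSMul {κ ι σ A : Type*} [CommRing A] [Fintype ι] (D : Matrix κ ι A)
    (g : ι → MvPowerSeries σ A) : κ → MvPowerSeries σ A :=
  fun i => ∑ j, D i j • g j

theorem seriesComp_assoc {κ σ τ υ A : Type*} [CommRing A] [Finite σ] [Finite τ]
    (h : κ → MvPowerSeries σ A) (g : σ → MvPowerSeries τ A) (f : τ → MvPowerSeries υ A)
    (hg : ∀ i, (g i).constantCoeff = 0) (hf : ∀ i, (f i).constantCoeff = 0) :
    seriesComp (seriesComp h g) f = seriesComp h (seriesComp g f) := by
  funext i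
  exact MvPowerSeries.subst_comp_subst_apply
    (MvPowerSeries.hasSubst_of_constantCoeff_zero hg)
    (MvPowerSeries.hasSubst_of_constantCoeff_zero hf) (h i)

theorem seriesComp_X {κ σ A : Type*} [CommRing A] (g : κ → MvPowerSeries σ A) :
    seriesComp g MvPowerSeries.X = g := by
  funext i
  simp [seriesComp, MvPowerSeries.subst_self]

theorem X_seriesComp {σ τ A : Type*} [CommRing A] [Finite σ] (f : σ → MvPowerSeries τ A)
    (hf : ∀ i, (f i).constantCoeff = 0) :
    seriesComp MvPowerSeries.X f = f := by
  funext i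
  exact MvPowerSeries.subst_X (MvPowerSeries.hasSubst_of_constantCoeff_zero hf) i

theorem constantCoeff_seriesComp {κ σ τ A : Type*} [CommRing A] [Finite σ]
    (g : κ → MvPowerSeries σ A) (f : σ → MvPowerSeries τ A)
    (hg : ∀ i, (g i).constantCoeff = 0) (hf : ∀ i, (f i).constantCoeff = 0) (i : κ) :
    (seriesComp g f i).constantCoeff = 0 :=
  MvPowerSeries.constantCoeff_subst_eq_zero
    (MvPowerSeries.hasSubst_of_constantCoeff_zero hf) hf (hg i)

theorem seriesMap_seriesComp {κ σ τ A B : Type*} [CommRing A] [CommRing B] [Finite σ]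
    (φ : A →+* B) (g : κ → MvPowerSeries σ A) (f : σ → MvPowerSeries τ A)
    (hf : ∀ i, (f i).constantCoeff = 0) :
    seriesMap φ (seriesComp g f) = seriesComp (seriesMap φ g) (seriesMap φ f) := by
  funext i
  exact MvPowerSeries.map_subst (MvPowerSeries.hasSubst_of_constantCoeff_zero hf) (g i)

theorem seriesMap_X {σ A B : Type*} [CommRing A] [CommRing B] (φ : A →+* B) :
    seriesMap φ (MvPowerSeries.X : σ → MvPowerSeries σ A) = MvPowerSeries.X := by
  funext i
  simp [seriesMap]

theorem seriesMap_sumElim {κ κ' σ A B : Type*} [CommRing A] [CommRing B] (φ : A →+* B)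
    (a : κ → MvPowerSeries σ A) (b : κ' → MvPowerSeries σ A) :
    seriesMap φ (Sum.elim a b) = Sum.elim (seriesMap φ a) (seriesMap φ b) := by
  funext i
  cases i <;> rfl

theorem seriesMap_zero {κ σ A B : Type*} [CommRing A] [CommRing B] (φ : A →+* B) :
    seriesMap φ (0 : κ → MvPowerSeries σ A) = 0 := by
  funext i
  simp [seriesMap]

/-- The variables of the block of the index type selected by `j`. -/
def blockVars {κ σ : Type*} (A : Type*) [CommRing A] (j : κ → σ) : κ → MvPowerSeries σ A :=
  fun i => MvPowerSeries.X (j i)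

theorem seriesMap_blockVars {κ σ A B : Type*} [CommRing A] [CommRing B] (φ : A →+* B)
    (j : κ → σ) : seriesMap φ (blockVars A j) = blockVars B j := by
  funext i
  simp [seriesMap, blockVars]

theorem constantCoeff_blockVars {κ σ A : Type*} [CommRing A] (j : κ → σ) (i : κ) :
    (blockVars A j i).constantCoeff = 0 := by
  simp [blockVars]

theorem constantCoeff_sumElim {κ κ' σ A : Type*} [CommRing A]
    {a : κ → MvPowerSeries σ A} {b : κ' → MvPowerSeries σ A}
    (ha : ∀ i, (a i).constantCoeff = 0) (hb : ∀ i, (b i).constantCoeff = 0) (i : κ ⊕ κ') :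
    (Sum.elim a b i).constantCoeff = 0 := by
  cases i
  · exact ha _
  · exact hb _

/-- A (commutative) `d`-dimensional formal group law over `A`: a `d`-tuple `F(X, Y)` of power
series in two sets of `d` variables (`X` is the left and `Y` the right block) such that
`F(X, 0) = X`, `F(X, F(Y, Z)) = F(F(X, Y), Z)` and `F(X, Y) = F(Y, X)`. -/
structure FormalGroupLaw (A : Type*) [CommRing A] (d : ℕ) where
  toSeries : Fin d → MvPowerSeries (Fin d ⊕ Fin d) A
  add_zero : seriesComp toSeries (Sum.elim MvPowerSeries.X (0 : Fin d → MvPowerSeries (Fin d) A))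
    = MvPowerSeries.X
  assoc :
    seriesComp toSeries
      (Sum.elim (blockVars A (Sum.inl : Fin d → Fin d ⊕ (Fin d ⊕ Fin d)))
        (seriesComp toSeries
          (Sum.elim (blockVars A (Sum.inr ∘ Sum.inl)) (blockVars A (Sum.inr ∘ Sum.inr))))) =
    seriesComp toSeries
      (Sum.elim
        (seriesComp toSeries
          (Sum.elim (blockVars A (Sum.inl : Fin d → Fin d ⊕ (Fin d ⊕ Fin d)))
            (blockVars A (Sum.inr ∘ Sum.inl))))
        (blockVars A (Sum.inr ∘ Sum.inr)))
  comm : seriesComp toSeries (Sum.elim (blockVars A Sum.inr) (blockVars A Sum.inl)) = toSeries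

namespace FormalGroupLaw

theorem constantCoeff_toSeries {A : Type*} [CommRing A] {d : ℕ} (F : FormalGroupLaw A d)
    (i : Fin d) : (F.toSeries i).constantCoeff = 0 := by
  have hc : ∀ j, (Sum.elim MvPowerSeries.X (0 : Fin d → MvPowerSeries (Fin d) A)
      j).constantCoeff = 0 :=
    constantCoeff_sumElim (by simp) (by simp)
  have hs := MvPowerSeries.hasSubst_of_constantCoeff_zero hc
  have h := congrArg MvPowerSeries.constantCoeff (congrFun F.add_zero i)
  rw [seriesComp, MvPowerSeries.constantCoeff_X] at h
  have h2 : MvPowerSeries.constantCoeff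
      (MvPowerSeries.subst (Sum.elim MvPowerSeries.X (0 : Fin d → MvPowerSeries (Fin d) A))
        (F.toSeries i - MvPowerSeries.C (F.toSeries i).constantCoeff)) = 0 :=
    MvPowerSeries.constantCoeff_subst_eq_zero hs hc (by simp)
  have h3 : MvPowerSeries.subst (Sum.elim MvPowerSeries.X (0 : Fin d → MvPowerSeries (Fin d) A))
      (MvPowerSeries.C (F.toSeries i).constantCoeff) =
      (MvPowerSeries.C (F.toSeries i).constantCoeff : MvPowerSeries (Fin d) A) :=
    MvPowerSeries.subst_C _
  rw [MvPowerSeries.subst_sub hs, map_sub, h, h3] at h2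
  simpa using h2

/-- The same formal group law with coefficients taken in another ring. -/
def map {A B : Type*} [CommRing A] [CommRing B] {d : ℕ} (F : FormalGroupLaw A d)
    (φ : A →+* B) : FormalGroupLaw B d where
  toSeries := seriesMap φ F.toSeries
  add_zero := by
    have h := congrArg (seriesMap φ) F.add_zero
    rwa [seriesMap_seriesComp φ _ _ (constantCoeff_sumElim (by simp) (by simp)),
      seriesMap_sumElim, seriesMap_X, seriesMap_zero] at h
  assoc := by
    have hb := fun (j : Fin d → Fin d ⊕ (Fin d ⊕ Fin d)) => constantCoeff_blockVars (A := A) j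
    have hF := fun (j j' : Fin d → Fin d ⊕ (Fin d ⊕ Fin d)) =>
      constantCoeff_seriesComp F.toSeries (Sum.elim (blockVars A j) (blockVars A j'))
        F.constantCoeff_toSeries (constantCoeff_sumElim (hb j) (hb j'))
    have h := congrArg (seriesMap φ) F.assoc
    rwa [seriesMap_seriesComp φ _ _ (constantCoeff_sumElim (hb _) (hF _ _)),
      seriesMap_seriesComp φ _ _ (constantCoeff_sumElim (hF _ _) (hb _)),
      seriesMap_sumElim, seriesMap_sumElim,
      seriesMap_seriesComp φ _ _ (constantCoeff_sumElim (hb _) (hb _)),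
      seriesMap_seriesComp φ _ _ (constantCoeff_sumElim (hb _) (hb _)),
      seriesMap_sumElim, seriesMap_sumElim,
      seriesMap_blockVars, seriesMap_blockVars, seriesMap_blockVars] at h
  comm := by
    have h := congrArg (seriesMap φ) F.comm
    rwa [seriesMap_seriesComp φ _ _
      (constantCoeff_sumElim (constantCoeff_blockVars _) (constantCoeff_blockVars _)),
      seriesMap_sumElim, seriesMap_blockVars, seriesMap_blockVars] at h

/-- The `d`-dimensional additive formal group law `X + Y`. -/
def additive (A : Type*) [CommRing A] (d : ℕ) : FormalGroupLaw A d where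
  toSeries := fun i => MvPowerSeries.X (Sum.inl i) + MvPowerSeries.X (Sum.inr i)
  add_zero := by
    funext i
    have hs := MvPowerSeries.hasSubst_of_constantCoeff_zero
      (a := Sum.elim MvPowerSeries.X (0 : Fin d → MvPowerSeries (Fin d) A))
      (constantCoeff_sumElim (by simp) (by simp))
    simp [seriesComp, MvPowerSeries.subst_add hs, MvPowerSeries.subst_X hs]
  assoc := by
    have hb := fun (j : Fin d → Fin d ⊕ (Fin d ⊕ Fin d)) => constantCoeff_blockVars (A := A) j
    have key : ∀ a b : Fin d → MvPowerSeries (Fin d ⊕ (Fin d ⊕ Fin d)) A,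
        (∀ i, (a i).constantCoeff = 0) → (∀ i, (b i).constantCoeff = 0) →
        seriesComp (fun i : Fin d => (MvPowerSeries.X (Sum.inl i) + MvPowerSeries.X (Sum.inr i) :
          MvPowerSeries (Fin d ⊕ Fin d) A)) (Sum.elim a b) = a + b := by
      intro a b ha hb
      funext i
      have hs := MvPowerSeries.hasSubst_of_constantCoeff_zero (constantCoeff_sumElim ha hb)
      simp [seriesComp, MvPowerSeries.subst_add hs, MvPowerSeries.subst_X hs]
    have hadd : ∀ j j' : Fin d → Fin d ⊕ (Fin d ⊕ Fin d), ∀ i,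
        ((blockVars A j + blockVars A j') i).constantCoeff = 0 := by
      intro j j' i
      simp [blockVars]
    rw [key _ _ (hb _) (hb _), key _ _ (hb _) (hb _), key _ _ (hb _) (hadd _ _),
      key _ _ (hadd _ _) (hb _), _root_.add_assoc]
  comm := by
    funext i
    have hs := MvPowerSeries.hasSubst_of_constantCoeff_zero
      (constantCoeff_sumElim (constantCoeff_blockVars (A := A) (Sum.inr : Fin d → Fin d ⊕ Fin d))
        (constantCoeff_blockVars (A := A) (Sum.inl : Fin d → Fin d ⊕ Fin d)))
    simp [seriesComp, MvPowerSeries.subst_add hs, MvPowerSeries.subst_X hs, blockVars,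
      _root_.add_comm]

/-- A homomorphism `F → F'` of formal group laws of dimensions `d` and `d'`: a `d'`-tuple `f` of
power series in `d` variables with `f(0) = 0` and `f(F(X, Y)) = F'(f(X), f(Y))`. -/
@[ext]
structure Hom {A : Type*} [CommRing A] {d d' : ℕ} (F : FormalGroupLaw A d)
    (F' : FormalGroupLaw A d') where
  toSeries : Fin d' → MvPowerSeries (Fin d) A
  constantCoeff_eq_zero : ∀ i, (toSeries i).constantCoeff = 0
  map_add : seriesComp toSeries F.toSeries =
    seriesComp F'.toSeries
      (Sum.elim (seriesComp toSeries (blockVars A (Sum.inl : Fin d → Fin d ⊕ Fin d)))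
        (seriesComp toSeries (blockVars A (Sum.inr : Fin d → Fin d ⊕ Fin d))))

namespace Hom

variable {A : Type*} [CommRing A] {d d' d'' : ℕ} {F : FormalGroupLaw A d}
  {F' : FormalGroupLaw A d'} {F'' : FormalGroupLaw A d''}

/-- The linear coefficient: the matrix `D` with `f(X) ≡ D X mod deg 2`. -/
def linearCoeff (f : Hom F F') : Matrix (Fin d') (Fin d) A :=
  Matrix.of fun i j => MvPowerSeries.coeff (Finsupp.single j 1) (f.toSeries i)

variable (F) in
/-- The identity homomorphism. -/
def id : Hom F F where
  toSeries := MvPowerSeries.X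
  constantCoeff_eq_zero := by simp
  map_add := by
    rw [X_seriesComp _ F.constantCoeff_toSeries, X_seriesComp _ (constantCoeff_blockVars _),
      X_seriesComp _ (constantCoeff_blockVars _)]
    have h : Sum.elim (blockVars A (Sum.inl : Fin d → Fin d ⊕ Fin d)) (blockVars A Sum.inr) =
        MvPowerSeries.X := by
      funext i
      cases i <;> rfl
    rw [h, seriesComp_X]

/-- The composition `g ∘ f`. -/
def comp (g : Hom F' F'') (f : Hom F F') : Hom F F'' where
  toSeries := seriesComp g.toSeries f.toSeries
  constantCoeff_eq_zero :=
    constantCoeff_seriesComp _ _ g.constantCoeff_eq_zero f.constantCoeff_eq_zero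
  map_add := by
    have hb := fun (j : Fin d → Fin d ⊕ Fin d) => constantCoeff_blockVars (A := A) j
    have hb' := fun (j : Fin d' → Fin d' ⊕ Fin d') => constantCoeff_blockVars (A := A) j
    have hfb := fun (j : Fin d → Fin d ⊕ Fin d) =>
      constantCoeff_seriesComp f.toSeries _ f.constantCoeff_eq_zero (hb j)
    have hgb := fun (j : Fin d' → Fin d' ⊕ Fin d') =>
      constantCoeff_seriesComp g.toSeries _ g.constantCoeff_eq_zero (hb' j)
    have hpair : ∀ (a b : Fin d' → MvPowerSeries (Fin d ⊕ Fin d) A),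
        (∀ i, (a i).constantCoeff = 0) → (∀ i, (b i).constantCoeff = 0) →
        seriesComp (Sum.elim (seriesComp g.toSeries (blockVars A Sum.inl))
          (seriesComp g.toSeries (blockVars A Sum.inr))) (Sum.elim a b) =
        Sum.elim (seriesComp g.toSeries a) (seriesComp g.toSeries b) := by
      intro a b ha hb0
      have hab := constantCoeff_sumElim ha hb0
      have h1 : seriesComp (blockVars A (Sum.inl : Fin d' → Fin d' ⊕ Fin d')) (Sum.elim a b)
          = a := by
        funext i
        exact MvPowerSeries.subst_X (MvPowerSeries.hasSubst_of_constantCoeff_zero hab) (Sum.inl i)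
      have h2 : seriesComp (blockVars A (Sum.inr : Fin d' → Fin d' ⊕ Fin d')) (Sum.elim a b)
          = b := by
        funext i
        exact MvPowerSeries.subst_X (MvPowerSeries.hasSubst_of_constantCoeff_zero hab) (Sum.inr i)
      have e1 := seriesComp_assoc g.toSeries _ _ (hb' Sum.inl) hab
      have e2 := seriesComp_assoc g.toSeries _ _ (hb' Sum.inr) hab
      rw [h1] at e1
      rw [h2] at e2
      rw [← e1, ← e2]
      funext i
      cases i <;> rfl
    rw [seriesComp_assoc _ _ _ f.constantCoeff_eq_zero F.constantCoeff_toSeries, f.map_add,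
      ← seriesComp_assoc _ _ _ F'.constantCoeff_toSeries (constantCoeff_sumElim (hfb _) (hfb _)),
      g.map_add,
      seriesComp_assoc _ _ _ (constantCoeff_sumElim (hgb _) (hgb _))
        (constantCoeff_sumElim (hfb _) (hfb _)),
      hpair _ _ (hfb _) (hfb _),
      seriesComp_assoc _ _ _ f.constantCoeff_eq_zero (hb _),
      seriesComp_assoc _ _ _ f.constantCoeff_eq_zero (hb _)]

/-- The endomorphisms of a formal group law form a monoid under composition. -/
instance : Monoid (Hom F F) where
  mul g f := g.comp f
  one := Hom.id F
  mul_assoc h g f := Hom.ext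
    (seriesComp_assoc _ _ _ g.constantCoeff_eq_zero f.constantCoeff_eq_zero)
  one_mul f := Hom.ext (X_seriesComp _ f.constantCoeff_eq_zero)
  mul_one f := Hom.ext (seriesComp_X _)

end Hom

/-- The automorphism group of a formal group law (under composition). -/
abbrev Aut {A : Type*} [CommRing A] {d : ℕ} (F : FormalGroupLaw A d) : Type _ := (Hom F F)ˣ

/-- `(F, f)` is a fixed pair for the action `ρ` of `G` on `Φ`: `σ ∘ f = f` for all `σ ∈ G`. -/
def IsFixedPair {A G : Type*} [CommRing A] [Group G] {r d : ℕ} {Φ : FormalGroupLaw A r}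
    (ρ : G →* Φ.Aut) {F : FormalGroupLaw A d} (f : Hom F Φ) : Prop :=
  ∀ s : G, (ρ s : Hom Φ Φ).comp f = f

/-- `(F, f)` is a universal fixed pair: it is fixed, and every fixed pair `(F', f')`, of any
dimension, factors as `f' = f ∘ g` for a unique homomorphism `g : F' → F`. -/
def IsUniversalFixedPair {A G : Type*} [CommRing A] [Group G] {r d : ℕ}
    {Φ : FormalGroupLaw A r} (ρ : G →* Φ.Aut) {F : FormalGroupLaw A d} (f : Hom F Φ) : Prop :=
  IsFixedPair ρ f ∧
    ∀ (d' : ℕ) (F' : FormalGroupLaw A d') (f' : Hom F' Φ), IsFixedPair ρ f' →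
      ∃! g : Hom F' F, f' = f.comp g

/-- `l` is the logarithm of the formal group law `F` over `ℤ`: a homomorphism over `ℚ` to the
additive formal group law with `l(X) ≡ X mod deg 2`. -/
def IsLogarithm {d : ℕ} {F : FormalGroupLaw ℤ d}
    (l : Hom (F.map (Int.castRingHom ℚ)) (additive ℚ d)) : Prop :=
  l.linearCoeff = 1

end FormalGroupLaw

section Types

variable (p : ℕ) [Fact p.Prime]

/-- The action of `a = ∑ aₙ ▲ⁿ ∈ ℤ_p[[▲]]` on a power series `g` over `ℚ_p` without constant term,
where `▲` replaces each variable by its `p`-th power: `a g = ∑ aₙ g(X^(p^n))`. In degree `m ≠ 0`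
only the finitely many `n` with `p^n ≤ |m|` contribute. -/
def frobAct {σ : Type*} (a : PowerSeries ℤ_[p]) (g : MvPowerSeries σ ℚ_[p]) :
    MvPowerSeries σ ℚ_[p] :=
  fun m => ∑ n ∈ Finset.range (m.degree + 1),
    ((PowerSeries.coeff n a : ℤ_[p]) : ℚ_[p]) *
      MvPowerSeries.coeff m
        (MvPowerSeries.expand (p ^ n) (pow_ne_zero n (Fact.out : p.Prime).ne_zero) g)

/-- The action of a matrix over `ℤ_p[[▲]]` on a column of power series over `ℚ_p`. -/
def frobMatrixAct {d : ℕ} {σ : Type*} (u : Matrix (Fin d) (Fin d) (PowerSeries ℤ_[p]))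
    (l : Fin d → MvPowerSeries σ ℚ_[p]) : Fin d → MvPowerSeries σ ℚ_[p] :=
  fun i => ∑ j, frobAct p (u i j) (l j)

/-- `l` is of type `u`: `u ≡ p I mod ▲` and `u l ≡ 0 mod p`, that is, all the coefficients of
`u l` lie in `p ℤ_p`. -/
def IsOfType {d : ℕ} (u : Matrix (Fin d) (Fin d) (PowerSeries ℤ_[p]))
    (l : Fin d → MvPowerSeries (Fin d) ℚ_[p]) : Prop :=
  u.map PowerSeries.constantCoeff = (p : ℤ_[p]) • (1 : Matrix (Fin d) (Fin d) ℤ_[p]) ∧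
    ∀ i m, ∃ c : ℤ_[p],
      MvPowerSeries.coeff m (frobMatrixAct p u l i) = ((p : ℤ_[p]) * c : ℤ_[p])

/-- A tuple over `ℚ` is of `p`-type `u` if it is of type `u` over `ℚ_p`. -/
def IsOfPType {d : ℕ} (u : Matrix (Fin d) (Fin d) (PowerSeries ℤ_[p]))
    (l : Fin d → MvPowerSeries (Fin d) ℚ) : Prop :=
  IsOfType p u (seriesMap (algebraMap ℚ ℚ_[p]) l)

/-- For an action `ρ` of `G` on `Φ` and the logarithm `L` of `Φ`, the set of the matrices `D` over
`ℤ_p` such that `L⁻¹ ∘ (D + I) L` is (the image of) an element of `G`, written in the form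
`L ∘ σ = (D + I) L` for some `σ ∈ G`. -/
def starSet {G : Type*} [Group G] {r : ℕ} {Φ : FormalGroupLaw ℤ r} (ρ : G →* Φ.Aut)
    (L : Fin r → MvPowerSeries (Fin r) ℚ) : Set (Matrix (Fin r) (Fin r) ℤ_[p]) :=
  {D | ∃ s : G,
    seriesComp (seriesMap (algebraMap ℚ ℚ_[p]) L)
        (seriesMap (Int.castRingHom ℚ_[p]) (ρ s : FormalGroupLaw.Hom Φ Φ).toSeries) =
      matrixSMul ((D + 1).map (fun x : ℤ_[p] => (x : ℚ_[p])))
        (seriesMap (algebraMap ℚ ℚ_[p]) L)}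

end Types

/-- The inclusion of the first `e` indices into `r`. -/
def topIdx {e r : ℕ} (he : e ≤ r) : Fin e → Fin r := Fin.castLE he

/-- The inclusion of the last `r - e` indices into `r`. -/
def botIdx {e r : ℕ} (he : e ≤ r) : Fin (r - e) → Fin r :=
  fun i => ⟨e + i, by have := i.isLt; omega⟩

/-- The `r × e` matrix with the identity matrix on top of the zero matrix. -/
def stdIncl (R : Type*) [CommRing R] (r e : ℕ) : Matrix (Fin r) (Fin e) R :=
  Matrix.of fun i j => if (i : ℕ) = j then 1 else 0

/-- The condition on a set `S` of `r × r` matrices, a number `e ≤ r` and `Q ∈ GL_r(R)`: for each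
`D ∈ S` the first `e` columns of `Q⁻¹ D Q` vanish, so that `Q⁻¹ D Q` consists of the blocks
`0, D^` (first `e` rows) and `0, D~` (last `r - e` rows), and there are `D₁, …, Dₘ ∈ S` and
matrices `Cᵢ^`, `Cᵢ~` such that `∑ Cᵢ^ Dᵢ^ + Cᵢ~ Dᵢ~` is invertible. -/
def BlockCondition {R : Type*} [CommRing R] {e r : ℕ} (he : e ≤ r)
    (S : Set (Matrix (Fin r) (Fin r) R)) (Q : Matrix.GeneralLinearGroup (Fin r) R) : Prop :=
  let conj : Matrix (Fin r) (Fin r) R → Matrix (Fin r) (Fin r) R :=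
    fun D => (↑Q⁻¹ : Matrix (Fin r) (Fin r) R) * D * (↑Q : Matrix (Fin r) (Fin r) R)
  (∀ D ∈ S, (conj D).submatrix _root_.id (topIdx he) = 0) ∧
    ∃ (m : ℕ) (D : Fin m → Matrix (Fin r) (Fin r) R)
      (Chat : Fin m → Matrix (Fin (r - e)) (Fin e) R)
      (Ctil : Fin m → Matrix (Fin (r - e)) (Fin (r - e)) R),
      (∀ i, D i ∈ S) ∧
        IsUnit (∑ i, (Chat i * (conj (D i)).submatrix (topIdx he) (botIdx he) +
          Ctil i * (conj (D i)).submatrix (botIdx he) (botIdx he)))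

/-- The upper-left `e × e` block of `Q⁻¹ v Q`, for `Q ∈ GL_r(ℤ)` and a matrix `v` over a ring. -/
def conjTopLeft {R : Type*} [CommRing R] {e r : ℕ} (he : e ≤ r)
    (Q : Matrix.GeneralLinearGroup (Fin r) ℤ) (v : Matrix (Fin r) (Fin r) R) :
    Matrix (Fin e) (Fin e) R :=
  ((↑Q⁻¹ : Matrix (Fin r) (Fin r) ℤ).map (Int.castRingHom R) * v *
    (↑Q : Matrix (Fin r) (Fin r) ℤ).map (Int.castRingHom R)).submatrix (topIdx he) (topIdx he)

end

/-! Composition with logarithms linearizes the problem. Over `ℚ` a homomorphism from a formal group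
law to an additive one is a constant matrix times the logarithm, so the `f` sought must be `Λ⁻¹ ∘ (B
λ)`, where `B = Q I_{r,e}` and `λ` is the logarithm of `F`. What has to be shown is integrality, and
Honda's theory of types decides it prime by prime. If `Λ` is of type `v`, a tuple `a` over `ℚ_p`
without constant term is integral exactly when `v (Λ ∘ a) ≡ 0 mod p`
(`isMultiple_frobTuple_seriesComp`, `IsNormalized.exists_coe_eq_coeff`). Moreover, `w Λ ≡ 0 mod p`
forces `w = t v` for some matrix `t` over `ℤ_p[[▲]]` (`IsNormalized.exists_eq_mul`).

The link between the action and the types is as follows. If `Λ ∘ σ = (D + 1) Λ` with `σ` in the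
group, then `v (D + 1) Λ ≡ 0 mod p`, hence `v D = W v` for some `W`, and `W ≡ D mod ▲` because `v ≡
p mod ▲`. After conjugation by `Q` the first `e` columns of `D`, hence of `W v`, vanish. The
combination of the blocks of the `Dᵢ` that is invertible by hypothesis lifts to a combination of the
blocks of the `Wᵢ` that is invertible over `ℤ_p[[▲]]`; solving for the lower left block of `Q⁻¹ v Q`
shows that it is a left multiple of the upper left block `u` (`exists_submatrix_eq_mul`). Therefore
`v B = Y u`, so `u λ ≡ 0` gives `v B λ ≡ 0`, and `f` is integral.

The pair is fixed because `D B = 0`. If `(F', f')` is fixed, then `μ = Λ ∘ f'` satisfies `D μ = 0`,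
and the invertible combination kills the lower part of `Q⁻¹ μ`; thus `μ = B μ₁`. Now `v B μ₁ ≡ 0`
yields `u μ₁ ≡ 0` on multiplying by `Q⁻¹` and keeping the upper rows, so `g = λ⁻¹ ∘ μ₁` is integral
and `f' = f ∘ g`. Uniqueness holds because `B` has a left inverse and composition with a logarithm
is injective. -/

noncomputable section

/-! ### Orders of power series under substitution. -/

namespace MvPowerSeries

section Order

variable {σ τ A : Type*} [CommRing A]

theorem le_order_sub {n : ℕ∞} {f g : MvPowerSeries σ A} (hf : n ≤ f.order) (hg : n ≤ g.order) :
    n ≤ (f - g).order := by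
  rw [sub_eq_add_neg]
  exact (le_min hf (by rwa [order_neg])).trans min_order_le_add

theorem le_order_add {n : ℕ∞} {f g : MvPowerSeries σ A} (hf : n ≤ f.order) (hg : n ≤ g.order) :
    n ≤ (f + g).order :=
  (le_min hf hg).trans min_order_le_add

theorem one_le_order {f : MvPowerSeries σ A} (hf : f.constantCoeff = 0) : 1 ≤ f.order :=
  one_le_order_iff_constCoeff_eq_zero.2 hf

theorem eq_of_forall_le_order_sub {f g : MvPowerSeries σ A} (h : ∀ n : ℕ, (n : ℕ∞) ≤ (f - g).order) :
    f = g := by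
  have : (f - g).order = ⊤ := ENat.eq_top_iff_forall_ge.2 h
  exact sub_eq_zero.1 (order_eq_top_iff.1 this)

theorem coeff_eq_of_lt_order_sub {f g : MvPowerSeries σ A} {m : σ →₀ ℕ}
    (h : (m.degree : ℕ∞) < (f - g).order) : coeff m f = coeff m g := by
  have := coeff_of_lt_order h
  rwa [map_sub, sub_eq_zero] at this

theorem order_le_order_subst [Finite σ] (f : MvPowerSeries σ A) {a : σ → MvPowerSeries τ A}
    (ha : ∀ i, (a i).constantCoeff = 0) : f.order ≤ (f.subst a).order := by
  refine le_trans ?_ (le_order_subst (hasSubst_of_constantCoeff_zero ha) f)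
  calc f.order = 1 * f.order := (one_mul _).symm
    _ ≤ _ := mul_le_mul_left (le_iInf fun i => one_le_order (ha i)) _

theorem degree_le_order_prod_pow {a : σ → MvPowerSeries τ A} (ha : ∀ i, (a i).constantCoeff = 0)
    (d : σ →₀ ℕ) : (d.degree : ℕ∞) ≤ (d.prod fun i n => a i ^ n).order := by
  refine le_trans ?_ (le_order_prod _ _)
  rw [Finsupp.degree_apply, Nat.cast_sum]
  refine Finset.sum_le_sum fun i _ => ?_
  refine le_trans ?_ (le_order_pow _)
  rw [nsmul_eq_mul]
  calc ((d i : ℕ) : ℕ∞) = d i * 1 := (mul_one _).symm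
    _ ≤ _ := mul_le_mul_right (one_le_order (ha i)) _

/-- Telescoping `A₁A₂ - B₁B₂ = A₁(A₂ - B₂) + (A₁ - B₁)B₂` makes the bound additive in `d`, which
reduces it to a single variable. The true bound is `N + |d| - 1`; the `1` stands on the right to
avoid truncated subtraction. -/
theorem le_order_prod_pow_sub {a b : σ → MvPowerSeries τ A} (ha : ∀ i, (a i).constantCoeff = 0)
    (hb : ∀ i, (b i).constantCoeff = 0) {N : ℕ} (h : ∀ i, (N : ℕ∞) ≤ (a i - b i).order)
    (d : σ →₀ ℕ) :
    ((N + d.degree : ℕ) : ℕ∞) ≤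
      ((d.prod fun i n => a i ^ n) - d.prod fun i n => b i ^ n).order + 1 := by
  classical
  have hadd : ∀ d e : σ →₀ ℕ,
      ((N + d.degree : ℕ) : ℕ∞) ≤
        ((d.prod fun i n => a i ^ n) - d.prod fun i n => b i ^ n).order + 1 →
      ((N + e.degree : ℕ) : ℕ∞) ≤
        ((e.prod fun i n => a i ^ n) - e.prod fun i n => b i ^ n).order + 1 →
      ((N + (d + e).degree : ℕ) : ℕ∞) ≤
        (((d + e).prod fun i n => a i ^ n) - (d + e).prod fun i n => b i ^ n).order + 1 := by
    intro d e hd he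
    rw [Finsupp.prod_add_index' (by simp) (by simp [pow_add]),
      Finsupp.prod_add_index' (by simp) (by simp [pow_add])]
    set A1 := d.prod fun i n => a i ^ n
    set A2 := e.prod fun i n => a i ^ n
    set B1 := d.prod fun i n => b i ^ n
    set B2 := e.prod fun i n => b i ^ n
    have h1 : (d.degree : ℕ∞) ≤ A1.order := degree_le_order_prod_pow ha d
    have h2 : (e.degree : ℕ∞) ≤ B2.order := degree_le_order_prod_pow hb e
    have e1 : A1 * A2 - B1 * B2 = A1 * (A2 - B2) + (A1 - B1) * B2 := by ring
    have h3 : A1.order + (A2 - B2).order ≤ (A1 * (A2 - B2)).order := le_order_mul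
    have h4 : (A1 - B1).order + B2.order ≤ ((A1 - B1) * B2).order := le_order_mul
    rw [e1]
    have h5 : ((N + (d + e).degree : ℕ) : ℕ∞) ≤ (A1 * (A2 - B2)).order + 1 := by
      calc ((N + (d + e).degree : ℕ) : ℕ∞) = d.degree + (N + e.degree : ℕ) := by
            rw [map_add]; push_cast; ring
        _ ≤ A1.order + ((A2 - B2).order + 1) := add_le_add h1 he
        _ ≤ _ := by rw [← add_assoc]; gcongr
    have h6 : ((N + (d + e).degree : ℕ) : ℕ∞) ≤ ((A1 - B1) * B2).order + 1 := by
      calc ((N + (d + e).degree : ℕ) : ℕ∞) = (N + d.degree : ℕ) + e.degree := by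
            rw [map_add]; push_cast; ring
        _ ≤ ((A1 - B1).order + 1) + B2.order := add_le_add hd h2
        _ = ((A1 - B1).order + B2.order) + 1 := by ring
        _ ≤ _ := by gcongr
    calc _ ≤ min ((A1 * (A2 - B2)).order + 1) (((A1 - B1) * B2).order + 1) := le_min h5 h6
      _ = min (A1 * (A2 - B2)).order ((A1 - B1) * B2).order + 1 := (min_add_add_right _ _ _)
      _ ≤ _ := by gcongr; exact min_order_le_add
  induction d using Finsupp.induction_linear with
  | zero => simp
  | add d e hd he => exact hadd d e hd he
  | single i n =>
    induction n with
    | zero => simp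
    | succ n ih =>
      rw [Finsupp.single_add]
      refine hadd _ _ ih ?_
      simpa using add_le_add_left (h i) 1

/-- Each monomial of degree at least `2` gains at least one order over the difference of the
arguments. This is the contraction estimate behind inverting a series `X + …` under composition. -/
theorem le_order_subst_sub_subst [Finite σ] {a b : σ → MvPowerSeries τ A}
    (ha : ∀ i, (a i).constantCoeff = 0) (hb : ∀ i, (b i).constantCoeff = 0) {N : ℕ}
    (h : ∀ i, (N : ℕ∞) ≤ (a i - b i).order) {f : MvPowerSeries σ A} (hf : 2 ≤ f.order) :
    ((N + 1 : ℕ) : ℕ∞) ≤ (f.subst a - f.subst b).order := by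
  refine le_order fun e he => ?_
  rw [map_sub, sub_eq_zero, coeff_subst (hasSubst_of_constantCoeff_zero ha),
    coeff_subst (hasSubst_of_constantCoeff_zero hb)]
  refine finsum_congr fun d => ?_
  by_cases hd : d.degree < 2
  · rw [coeff_of_lt_order (lt_of_lt_of_le (by exact_mod_cast hd) hf), zero_smul, zero_smul]
  · congr 1
    refine coeff_eq_of_lt_order_sub (lt_of_lt_of_le he ?_)
    have h1 := le_order_prod_pow_sub ha hb h d
    have h2 : ((N + 1 : ℕ) : ℕ∞) + 1 ≤ ((N + d.degree : ℕ) : ℕ∞) := by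
      exact_mod_cast (by omega : N + 1 + 1 ≤ N + d.degree)
    exact (ENat.add_le_add_iff_right (by simp)).1 (h2.trans h1)

end Order

end MvPowerSeries

/-! ### Tuples congruent to `X` modulo degree 2 and their inversion under composition. -/

open MvPowerSeries

/-- A tuple of power series `L` with `L(X) ≡ X mod deg 2`. -/
structure IsNormalized {A : Type*} [CommRing A] {d : ℕ} (L : Fin d → MvPowerSeries (Fin d) A) :
    Prop where
  constantCoeff_eq_zero : ∀ i, (L i).constantCoeff = 0
  coeff_single : ∀ i j, coeff (Finsupp.single j 1) (L i) = if i = j then 1 else 0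

theorem Finsupp.exists_eq_single_of_degree_eq_one {σ : Type*} {m : σ →₀ ℕ} (h : m.degree = 1) :
    ∃ j, m = Finsupp.single j 1 :=
  (Finsupp.sum_eq_one_iff m).1 h

namespace IsNormalized

variable {A τ : Type*} [CommRing A] {d : ℕ} {L : Fin d → MvPowerSeries (Fin d) A}

theorem two_le_order_sub_X (hL : IsNormalized L) (i : Fin d) : 2 ≤ (L i - X i).order := by
  refine nat_le_order (n := 2) fun m hm => ?_
  have : m.degree = 0 ∨ m.degree = 1 := by omega
  rcases this with h | h
  · rw [Finsupp.degree_eq_zero_iff] at h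
    subst h
    simp [hL.constantCoeff_eq_zero]
  · obtain ⟨j, rfl⟩ := Finsupp.exists_eq_single_of_degree_eq_one h
    classical
    rw [map_sub, hL.coeff_single, coeff_X]
    simp [Finsupp.single_left_inj, eq_comm]

theorem map {B : Type*} [CommRing B] (hL : IsNormalized L) (φ : A →+* B) :
    IsNormalized (seriesMap φ L) where
  constantCoeff_eq_zero i := by simp [seriesMap, hL.constantCoeff_eq_zero]
  coeff_single i j := by simp [seriesMap, hL.coeff_single, apply_ite φ]

/-- To first order `L` acts on differences as the identity, since `L - X` has order at least `2`. -/
theorem le_order_comp_sub (hL : IsNormalized L) {a b : Fin d → MvPowerSeries τ A}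
    (ha : ∀ i, (a i).constantCoeff = 0) (hb : ∀ i, (b i).constantCoeff = 0) {N : ℕ}
    (h : ∀ i, (N : ℕ∞) ≤ (a i - b i).order) (i : Fin d) :
    ((N + 1 : ℕ) : ℕ∞) ≤ (seriesComp L a i - seriesComp L b i - (a i - b i)).order := by
  have h1 := le_order_subst_sub_subst ha hb h (hL.two_le_order_sub_X i)
  have hsa := hasSubst_of_constantCoeff_zero ha
  have hsb := hasSubst_of_constantCoeff_zero hb
  rw [subst_sub hsa, subst_sub hsb, subst_X hsa, subst_X hsb] at h1
  convert h1 using 2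
  simp only [seriesComp]
  ring

theorem seriesComp_injective (hL : IsNormalized L) {a b : Fin d → MvPowerSeries τ A}
    (ha : ∀ i, (a i).constantCoeff = 0) (hb : ∀ i, (b i).constantCoeff = 0)
    (h : seriesComp L a = seriesComp L b) : a = b := by
  have key : ∀ N : ℕ, ∀ i, (N : ℕ∞) ≤ (a i - b i).order := by
    intro N
    induction N with
    | zero => simp
    | succ N ih =>
      intro i
      have := hL.le_order_comp_sub ha hb ih i
      rwa [h, sub_self, zero_sub, order_neg] at this
  funext i
  exact eq_of_forall_le_order_sub fun n => key n i

theorem exists_seriesComp_eq (hL : IsNormalized L) {M : Fin d → MvPowerSeries τ A}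
    (hM : ∀ i, (M i).constantCoeff = 0) :
    ∃ a : Fin d → MvPowerSeries τ A, (∀ i, (a i).constantCoeff = 0) ∧ seriesComp L a = M := by
  -- Fixed-point iteration for `a ↦ M - L(a) + a`, which is contracting for the order.
  let s : ℕ → Fin d → MvPowerSeries τ A :=
    fun n => Nat.rec 0 (fun _ a => M - seriesComp L a + a) n
  have hs : ∀ n, s (n + 1) = M - seriesComp L (s n) + s n := fun n => rfl
  have hs0 : ∀ n i, (s n i).constantCoeff = 0 := by
    intro n
    induction n with
    | zero => intro i; exact map_zero _
    | succ n ih =>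
      intro i
      rw [hs, Pi.add_apply, Pi.sub_apply, map_add, map_sub, hM, ih,
        constantCoeff_seriesComp _ _ hL.constantCoeff_eq_zero ih]
      simp
  have hstep : ∀ n : ℕ, ∀ i, ((n + 1 : ℕ) : ℕ∞) ≤ (s (n + 1) i - s n i).order := by
    intro n
    induction n with
    | zero =>
      intro i
      refine one_le_order ?_
      rw [map_sub, hs0 0 i, hs0 (0 + 1) i, sub_zero]
    | succ n ih =>
      intro i
      have := hL.le_order_comp_sub (hs0 (n + 1)) (hs0 n) ih i
      have h1 : s (n + 1 + 1) i - s (n + 1) i =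
          -(seriesComp L (s (n + 1)) i - seriesComp L (s n) i - (s (n + 1) i - s n i)) := by
        have e1 := congrFun (hs (n + 1)) i
        have e2 := congrFun (hs n) i
        simp only [Pi.add_apply, Pi.sub_apply] at e1 e2
        linear_combination e1 - e2
      rwa [h1, order_neg]
  have hstab : ∀ (n k : ℕ) (i : Fin d) (m : τ →₀ ℕ), m.degree ≤ n → n ≤ k →
      coeff m (s k i) = coeff m (s n i) := by
    intro n k i m hm hk
    induction k, hk using Nat.le_induction with
    | base => rfl
    | succ k hk ih =>
      rw [← ih]
      refine coeff_eq_of_lt_order_sub (lt_of_lt_of_le ?_ (hstep k i))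
      exact_mod_cast (by omega : m.degree < k + 1)
  -- The limit: `s (n + 1) - s n` has order at least `n + 1`, so a coefficient of degree `n` is
  -- final from stage `n` on.
  let a : Fin d → MvPowerSeries τ A := fun i m => coeff m (s m.degree i)
  have hca : ∀ i m, coeff m (a i) = coeff m (s m.degree i) := fun i m => rfl
  have ha : ∀ n : ℕ, ∀ i, ((n : ℕ) : ℕ∞) ≤ (a i - s n i).order := by
    intro n i
    refine nat_le_order fun m hm => ?_
    rw [map_sub, hca, hstab _ _ i m le_rfl hm.le, sub_self]
  have ha0 : ∀ i, (a i).constantCoeff = 0 := by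
    intro i
    rw [← coeff_zero_eq_constantCoeff_apply, hca, coeff_zero_eq_constantCoeff_apply, hs0]
  refine ⟨a, ha0, ?_⟩
  funext i
  refine eq_of_forall_le_order_sub fun n => ?_
  have h1 := hL.le_order_comp_sub ha0 (hs0 n) (ha n) i
  have h2 := hstep n i
  have h3 : ((n : ℕ) : ℕ∞) ≤ ((n + 1 : ℕ) : ℕ∞) := by exact_mod_cast n.le_succ
  have h4 : seriesComp L a i - M i = (seriesComp L a i - seriesComp L (s n) i - (a i - s n i)) +
      ((a i - s n i) - (s (n + 1) i - s n i)) := by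
    rw [hs]
    simp only [Pi.add_apply, Pi.sub_apply]
    ring
  rw [h4]
  exact le_order_add (h3.trans h1) (le_order_sub (ha n i) (h3.trans h2))

theorem coeff_single_seriesComp (hL : IsNormalized L) {a : Fin d → MvPowerSeries τ A}
    (ha : ∀ i, (a i).constantCoeff = 0) (i : Fin d) (j : τ) :
    coeff (Finsupp.single j 1) (seriesComp L a i) = coeff (Finsupp.single j 1) (a i) := by
  have h := hL.le_order_comp_sub (N := 1) ha (b := 0) (by simp)
    (fun i => one_le_order (by simpa using ha i)) i
  have h0 : seriesComp L (0 : Fin d → MvPowerSeries τ A) i = 0 :=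
    subst_zero_of_constantCoeff_zero (hL.constantCoeff_eq_zero i)
  rw [h0] at h
  refine coeff_eq_of_lt_order_sub (lt_of_lt_of_le ?_ (by simpa using h))
  simp

end IsNormalized

/-! ### Base change and constant matrices acting on tuples of series. -/

section SeriesTuples

variable {κ κ' ι σ τ A B : Type*} [CommRing A] [CommRing B]

theorem constantCoeff_seriesMap (φ : A →+* B) {g : κ → MvPowerSeries σ A}
    (hg : ∀ i, (g i).constantCoeff = 0) (i : κ) : (seriesMap φ g i).constantCoeff = 0 := by
  simp [seriesMap, hg i]

theorem seriesMap_injective {φ : A →+* B} (hφ : Function.Injective φ) {f g : κ → MvPowerSeries σ A}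
    (h : seriesMap φ f = seriesMap φ g) : f = g := by
  funext i
  ext m
  apply hφ
  have := congrArg (coeff m) (congrFun h i)
  simpa [seriesMap] using this

theorem seriesMap_seriesMap {C : Type*} [CommRing C] (ψ : B →+* C) (φ : A →+* B)
    (g : κ → MvPowerSeries σ A) : seriesMap ψ (seriesMap φ g) = seriesMap (ψ.comp φ) g := by
  funext i
  ext m
  simp [seriesMap]

theorem seriesComp_sumElim (a : κ → MvPowerSeries σ A) (b : κ' → MvPowerSeries σ A)
    (c : σ → MvPowerSeries τ A) :
    seriesComp (Sum.elim a b) c = Sum.elim (seriesComp a c) (seriesComp b c) := by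
  funext i
  cases i <;> rfl

theorem seriesComp_blockVars [Finite σ] (j : κ → σ) {c : σ → MvPowerSeries τ A}
    (hc : ∀ i, (c i).constantCoeff = 0) : seriesComp (blockVars A j) c = c ∘ j := by
  funext i
  exact subst_X (hasSubst_of_constantCoeff_zero hc) (j i)

section MatrixSMul

variable [Fintype ι]

theorem constantCoeff_matrixSMul (D : Matrix κ ι A) {g : ι → MvPowerSeries σ A}
    (hg : ∀ i, (g i).constantCoeff = 0) (i : κ) : (matrixSMul D g i).constantCoeff = 0 := by
  rw [matrixSMul, map_sum]
  exact Finset.sum_eq_zero fun j _ => by rw [← coeff_zero_eq_constantCoeff_apply, coeff_smul,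
    coeff_zero_eq_constantCoeff_apply, hg, mul_zero]

theorem coeff_matrixSMul (D : Matrix κ ι A) (g : ι → MvPowerSeries σ A) (i : κ) (m : σ →₀ ℕ) :
    coeff m (matrixSMul D g i) = ∑ j, D i j * coeff m (g j) := by
  simp [matrixSMul]

theorem matrixSMul_add (D : Matrix κ ι A) (g h : ι → MvPowerSeries σ A) :
    matrixSMul D (g + h) = matrixSMul D g + matrixSMul D h := by
  funext i
  simp [matrixSMul, Finset.sum_add_distrib]

theorem add_matrixSMul (D E : Matrix κ ι A) (g : ι → MvPowerSeries σ A) :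
    matrixSMul (D + E) g = matrixSMul D g + matrixSMul E g := by
  funext i
  simp [matrixSMul, Finset.sum_add_distrib, add_smul]

theorem one_matrixSMul [DecidableEq ι] (g : ι → MvPowerSeries σ A) :
    matrixSMul (1 : Matrix ι ι A) g = g := by
  funext i
  simp [matrixSMul, Matrix.one_apply, ite_smul]

theorem zero_matrixSMul (g : ι → MvPowerSeries σ A) : matrixSMul (0 : Matrix κ ι A) g = 0 := by
  funext i
  simp [matrixSMul]

theorem mul_matrixSMul [Fintype κ'] (D : Matrix κ κ' A) (E : Matrix κ' ι A)
    (g : ι → MvPowerSeries σ A) : matrixSMul (D * E) g = matrixSMul D (matrixSMul E g) := by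
  funext i
  simp only [matrixSMul, Matrix.mul_apply, Finset.sum_smul, Finset.smul_sum, smul_smul]
  exact Finset.sum_comm

theorem seriesComp_matrixSMul [Finite σ] (D : Matrix κ ι A) (g : ι → MvPowerSeries σ A)
    {c : σ → MvPowerSeries τ A} (hc : ∀ i, (c i).constantCoeff = 0) :
    seriesComp (matrixSMul D g) c = matrixSMul D (seriesComp g c) := by
  have hs := hasSubst_of_constantCoeff_zero hc
  funext i
  simp only [seriesComp, matrixSMul]
  rw [← substAlgHom_apply hs, map_sum]
  simp

theorem seriesMap_matrixSMul (φ : A →+* B) (D : Matrix κ ι A) (g : ι → MvPowerSeries σ A) :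
    seriesMap φ (matrixSMul D g) = matrixSMul (D.map φ) (seriesMap φ g) := by
  funext i
  ext m
  simp [seriesMap, matrixSMul]

end MatrixSMul

end SeriesTuples

/-! ### Homomorphisms seen through the logarithm. -/

namespace FormalGroupLaw

variable {A B τ : Type*} [CommRing A] [CommRing B] {d d' d'' : ℕ}

theorem additive_seriesComp (a b : Fin d → MvPowerSeries τ A)
    (ha : ∀ i, (a i).constantCoeff = 0) (hb : ∀ i, (b i).constantCoeff = 0) :
    seriesComp (additive A d).toSeries (Sum.elim a b) = a + b := by
  have hs := hasSubst_of_constantCoeff_zero (constantCoeff_sumElim ha hb)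
  funext i
  simp [seriesComp, additive, subst_add hs, subst_X hs]

theorem constantCoeff_seriesComp_toSeries (F : FormalGroupLaw A d) {a b : Fin d → MvPowerSeries τ A}
    (ha : ∀ i, (a i).constantCoeff = 0) (hb : ∀ i, (b i).constantCoeff = 0) (i : Fin d) :
    (seriesComp F.toSeries (Sum.elim a b) i).constantCoeff = 0 :=
  constantCoeff_seriesComp _ _ F.constantCoeff_toSeries (constantCoeff_sumElim ha hb) i

namespace Hom

variable {F : FormalGroupLaw A d} {F' : FormalGroupLaw A d'}

theorem map_seriesComp (f : Hom F F') {a b : Fin d → MvPowerSeries τ A}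
    (ha : ∀ i, (a i).constantCoeff = 0) (hb : ∀ i, (b i).constantCoeff = 0) :
    seriesComp f.toSeries (seriesComp F.toSeries (Sum.elim a b)) =
      seriesComp F'.toSeries
        (Sum.elim (seriesComp f.toSeries a) (seriesComp f.toSeries b)) := by
  have hab := constantCoeff_sumElim ha hb
  have hf := fun j : Fin d → Fin d ⊕ Fin d => constantCoeff_seriesComp f.toSeries _
    f.constantCoeff_eq_zero (constantCoeff_blockVars (A := A) j)
  have h := congrArg (fun g => seriesComp g (Sum.elim a b)) f.map_add
  rw [seriesComp_assoc _ _ _ F.constantCoeff_toSeries hab,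
    seriesComp_assoc _ _ _ (constantCoeff_sumElim (hf _) (hf _)) hab, seriesComp_sumElim,
    seriesComp_assoc _ _ _ (constantCoeff_blockVars _) hab,
    seriesComp_assoc _ _ _ (constantCoeff_blockVars _) hab,
    seriesComp_blockVars _ hab, seriesComp_blockVars _ hab] at h
  simpa using h

theorem additive_map_seriesComp (f : Hom F (additive A d')) {a b : Fin d → MvPowerSeries τ A}
    (ha : ∀ i, (a i).constantCoeff = 0) (hb : ∀ i, (b i).constantCoeff = 0) :
    seriesComp f.toSeries (seriesComp F.toSeries (Sum.elim a b)) =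
      seriesComp f.toSeries a + seriesComp f.toSeries b := by
  rw [f.map_seriesComp ha hb, additive_seriesComp _ _
    (constantCoeff_seriesComp _ _ f.constantCoeff_eq_zero ha)
    (constantCoeff_seriesComp _ _ f.constantCoeff_eq_zero hb)]

/-- Base change of a homomorphism of formal group laws. -/
def map (f : Hom F F') (φ : A →+* B) : Hom (F.map φ) (F'.map φ) where
  toSeries := seriesMap φ f.toSeries
  constantCoeff_eq_zero := constantCoeff_seriesMap φ f.constantCoeff_eq_zero
  map_add := by
    have hf := fun j : Fin d → Fin d ⊕ Fin d => constantCoeff_seriesComp f.toSeries _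
      f.constantCoeff_eq_zero (constantCoeff_blockVars (A := A) j)
    have h := congrArg (seriesMap φ) f.map_add
    rwa [seriesMap_seriesComp _ _ _ F.constantCoeff_toSeries,
      seriesMap_seriesComp _ _ _ (constantCoeff_sumElim (hf _) (hf _)), seriesMap_sumElim,
      seriesMap_seriesComp _ _ _ (constantCoeff_blockVars _),
      seriesMap_seriesComp _ _ _ (constantCoeff_blockVars _),
      seriesMap_blockVars, seriesMap_blockVars] at h

/-- The product of a matrix with a homomorphism to an additive formal group law. -/
def smulAdditive (D : Matrix (Fin d'') (Fin d') A) (f : Hom F (additive A d')) :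
    Hom F (additive A d'') where
  toSeries := matrixSMul D f.toSeries
  constantCoeff_eq_zero := constantCoeff_matrixSMul D f.constantCoeff_eq_zero
  map_add := by
    have hf := fun j : Fin d → Fin d ⊕ Fin d => constantCoeff_seriesComp (matrixSMul D f.toSeries) _
      (constantCoeff_matrixSMul D f.constantCoeff_eq_zero) (constantCoeff_blockVars (A := A) j)
    have h : F.toSeries = seriesComp F.toSeries (Sum.elim (blockVars A Sum.inl)
        (blockVars A Sum.inr)) := by
      have h : Sum.elim (blockVars A (Sum.inl : Fin d → Fin d ⊕ Fin d)) (blockVars A Sum.inr) =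
          MvPowerSeries.X := by
        funext i
        cases i <;> rfl
      rw [h, seriesComp_X]
    rw [additive_seriesComp _ _ (hf _) (hf _), seriesComp_matrixSMul _ _ F.constantCoeff_toSeries,
      seriesComp_matrixSMul _ _ (constantCoeff_blockVars _),
      seriesComp_matrixSMul _ _ (constantCoeff_blockVars _), ← matrixSMul_add]
    conv_lhs => rw [h]
    rw [f.additive_map_seriesComp (constantCoeff_blockVars _) (constantCoeff_blockVars _)]

theorem isNormalized {L : Hom F (additive A d)} (hL : L.linearCoeff = 1) :
    IsNormalized L.toSeries where
  constantCoeff_eq_zero := L.constantCoeff_eq_zero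
  coeff_single i j := by
    have := congrFun (congrFun hL i) j
    rwa [Matrix.one_apply] at this

/-- In characteristic zero a homomorphism to an additive formal group law is a matrix multiple of
the logarithm. -/
theorem toSeries_eq_matrixSMul [IsDomain A] [CharZero A] {L : Hom F (additive A d)}
    (hL : L.linearCoeff = 1) (N : Hom F (additive A d')) :
    N.toSeries = matrixSMul N.linearCoeff L.toSeries := by
  have hn := isNormalized hL
  obtain ⟨k, hk0, hk⟩ := hn.exists_seriesComp_eq (M := X) (by simp)
  have hXX : ∀ i, ((X + X : Fin d → MvPowerSeries (Fin d) A) i).constantCoeff = 0 := by simp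
  have hkL : seriesComp k L.toSeries = X := by
    refine hn.seriesComp_injective
      (constantCoeff_seriesComp _ _ hk0 L.constantCoeff_eq_zero) (by simp) ?_
    rw [← seriesComp_assoc _ _ _ hk0 L.constantCoeff_eq_zero, hk, seriesComp_X,
      X_seriesComp _ L.constantCoeff_eq_zero]
  -- Here `k = L⁻¹`. Compatibility with doubling is all the additivity that is needed.
  have hdouble : seriesComp F.toSeries (Sum.elim k k) = seriesComp k (X + X) := by
    refine hn.seriesComp_injective (F.constantCoeff_seriesComp_toSeries hk0 hk0)
      (constantCoeff_seriesComp _ _ hk0 hXX) ?_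
    rw [L.additive_map_seriesComp hk0 hk0, ← seriesComp_assoc _ _ _ hk0 hXX, hk,
      X_seriesComp _ hXX]
  set M := seriesComp N.toSeries k with hM
  have hM2 : seriesComp M (X + X) = M + M := by
    rw [hM, seriesComp_assoc _ _ _ hk0 hXX, ← hdouble, N.additive_map_seriesComp hk0 hk0]
  -- `M(2X) = 2 M(X)` says that `2 ^ |m| - 2` annihilates the coefficient at `m`; in a domain of
  -- characteristic zero only the linear part of `M` survives.
  have hcoeff : ∀ i (m : Fin d →₀ ℕ), m.degree ≠ 1 → coeff m (M i) = 0 := by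
    intro i m hm
    have h1 : seriesComp M (X + X) i = rescale (fun _ => (2 : A)) (M i) := by
      rw [rescale_eq_subst]
      simp only [seriesComp]
      congr 1
      funext j
      simp [two_smul]
    have h2 := congrFun hM2 i
    rw [h1] at h2
    have h3 := congrArg (coeff m) h2
    rw [coeff_rescale, Pi.add_apply, _root_.map_add, Finsupp.prod, Finset.prod_pow_eq_pow_sum,
      ← Finsupp.degree_apply, ← two_mul, ← sub_eq_zero, ← sub_mul] at h3
    refine (mul_eq_zero.1 h3).resolve_left ?_
    intro h4
    rw [sub_eq_zero] at h4
    have h5 : 2 ^ m.degree = 2 ^ 1 := by exact_mod_cast h4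
    exact hm (Nat.pow_right_injective le_rfl h5)
  obtain ⟨E, hE⟩ : ∃ E : Matrix (Fin d') (Fin d) A, M = matrixSMul E X := by
    refine ⟨Matrix.of fun i j => coeff (Finsupp.single j 1) (M i), ?_⟩
    classical
    funext i
    ext m
    rw [coeff_matrixSMul]
    by_cases hm : m.degree = 1
    · obtain ⟨j, rfl⟩ := Finsupp.exists_eq_single_of_degree_eq_one hm
      simp [coeff_X, Finsupp.single_left_inj]
    · rw [hcoeff i m hm]
      refine (Finset.sum_eq_zero fun j _ => ?_).symm
      rw [coeff_X, if_neg, mul_zero]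
      rintro rfl
      simp at hm
  have hN : N.toSeries = matrixSMul E L.toSeries := by
    rw [← X_seriesComp L.toSeries L.constantCoeff_eq_zero, ← seriesComp_matrixSMul _ _
      L.constantCoeff_eq_zero, ← hE, hM, seriesComp_assoc _ _ _ hk0 L.constantCoeff_eq_zero, hkL,
      seriesComp_X]
  rw [hN]
  congr 1
  ext i j
  rw [linearCoeff, Matrix.of_apply, hN, coeff_matrixSMul]
  simp [hn.coeff_single]

/-- A tuple of power series which the logarithm of `F'` transforms into a homomorphism to the
additive formal group law is a homomorphism. -/
theorem exists_toSeries_eq {φ : A →+* B} (hφ : Function.Injective φ)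
    {L : Hom (F'.map φ) (additive B d')} (hL : L.linearCoeff = 1)
    (M : Hom (F.map φ) (additive B d')) {a : Fin d' → MvPowerSeries (Fin d) A}
    (ha : ∀ i, (a i).constantCoeff = 0)
    (h : seriesComp L.toSeries (seriesMap φ a) = M.toSeries) : ∃ f : Hom F F', f.toSeries = a := by
  refine ⟨⟨a, ha, ?_⟩, rfl⟩
  have hb := fun j : Fin d → Fin d ⊕ Fin d => constantCoeff_blockVars (A := A) j
  have hb' := fun j : Fin d → Fin d ⊕ Fin d => constantCoeff_blockVars (A := B) j
  have hab := fun j : Fin d → Fin d ⊕ Fin d => constantCoeff_seriesComp a _ ha (hb j)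
  have ha' := constantCoeff_seriesMap φ ha
  have hab' := fun j : Fin d → Fin d ⊕ Fin d => constantCoeff_seriesComp (seriesMap φ a) _ ha' (hb' j)
  have hF : seriesMap φ F.toSeries = seriesComp (F.map φ).toSeries
      (Sum.elim (blockVars B Sum.inl) (blockVars B Sum.inr)) := by
    have h : Sum.elim (blockVars B (Sum.inl : Fin d → Fin d ⊕ Fin d)) (blockVars B Sum.inr) =
        MvPowerSeries.X := by
      funext i
      cases i <;> rfl
    rw [h, seriesComp_X]
    rfl
  -- It suffices to compare the two sides after base change and after applying `L`, where both
  -- become sums of values of `M`.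
  apply seriesMap_injective hφ
  refine (isNormalized hL).seriesComp_injective
    (constantCoeff_seriesMap _ (constantCoeff_seriesComp _ _ ha F.constantCoeff_toSeries))
    (constantCoeff_seriesMap _ (F'.constantCoeff_seriesComp_toSeries (hab _) (hab _))) ?_
  rw [seriesMap_seriesComp _ _ _ F.constantCoeff_toSeries,
    seriesMap_seriesComp _ _ _ (constantCoeff_sumElim (hab _) (hab _)), seriesMap_sumElim,
    seriesMap_seriesComp _ _ _ (hb _), seriesMap_seriesComp _ _ _ (hb _),
    seriesMap_blockVars, seriesMap_blockVars,
    ← seriesComp_assoc _ _ _ ha' (constantCoeff_seriesMap φ F.constantCoeff_toSeries), h, hF,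
    M.additive_map_seriesComp (hb' _) (hb' _)]
  refine Eq.trans ?_ (L.additive_map_seriesComp (hab' _) (hab' _)).symm
  rw [← seriesComp_assoc _ _ _ ha' (hb' _), ← seriesComp_assoc _ _ _ ha' (hb' _), h]

end Hom

end FormalGroupLaw

/-! ### The action of `ℤ_p[[▲]]` on power series. -/

theorem MvPowerSeries.coeff_expand_eq_zero {σ A : Type*} [CommRing A] {q : ℕ} (hq : q ≠ 0)
    (f : MvPowerSeries σ A) {m : σ →₀ ℕ} (hm : ∀ m' : σ →₀ ℕ, m ≠ q • m') :
    coeff m (expand q hq f) = 0 := by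
  by_contra h
  obtain ⟨m', -, h'⟩ := support_expand_subset q hq f (show m ∈ Function.support _ from h)
  exact hm m' h'.symm

/-- Since `n < p ^ n`, a nonzero multi-index divisible by `p ^ n` has degree greater than `n`. Hence
the finite range in `frobAct` loses nothing and may be enlarged at will. -/
theorem MvPowerSeries.coeff_expand_pow_eq_zero_of_degree_lt {σ A : Type*} [CommRing A] {p : ℕ}
    (hp : 1 < p) {n : ℕ} (hq : p ^ n ≠ 0) {f : MvPowerSeries σ A} (hf : f.constantCoeff = 0)
    {m : σ →₀ ℕ} (hm : m.degree < n) : coeff m (expand (p ^ n) hq f) = 0 := by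
  by_cases h0 : m = 0
  · rw [h0, coeff_zero_eq_constantCoeff_apply, constantCoeff_expand, hf]
  refine coeff_expand_eq_zero hq f fun m' hm' => ?_
  have h1 : m'.degree ≠ 0 := by
    rw [ne_eq, Finsupp.degree_eq_zero_iff]
    rintro rfl
    exact h0 (by simpa using hm')
  have h2 : m.degree = p ^ n * m'.degree := by rw [hm']; simp
  have h3 : n < p ^ n := Nat.lt_pow_self hp
  have h4 : p ^ n * 1 ≤ p ^ n * m'.degree := Nat.mul_le_mul_left _ (Nat.one_le_iff_ne_zero.2 h1)
  omega

section Padic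

variable (p : ℕ) [hp : Fact p.Prime]

/-- The submodule `p ℤ_p` of `ℚ_p`. -/
def padicMultiples : Submodule ℤ_[p] ℚ_[p] where
  carrier := {x | ∃ c : ℤ_[p], x = ((p : ℤ_[p]) * c : ℤ_[p])}
  add_mem' := by
    rintro _ _ ⟨a, rfl⟩ ⟨b, rfl⟩
    exact ⟨a + b, by push_cast; ring⟩
  zero_mem' := ⟨0, by simp⟩
  smul_mem' := by
    rintro c _ ⟨a, rfl⟩
    exact ⟨c * a, by rw [Algebra.smul_def, PadicInt.algebraMap_apply]; push_cast; ring⟩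

variable {p}

theorem coe_mul_mem_padicMultiples (a : ℤ_[p]) {x : ℚ_[p]} (hx : x ∈ padicMultiples p) :
    (a : ℚ_[p]) * x ∈ padicMultiples p := by
  have := (padicMultiples p).smul_mem a hx
  rwa [Algebra.smul_def, PadicInt.algebraMap_apply] at this

theorem natCast_ne_zero_padic : (p : ℚ_[p]) ≠ 0 := by
  exact_mod_cast hp.out.ne_zero

theorem mem_subring_of_natCast_mul_mem {x : ℚ_[p]} (hx : (p : ℚ_[p]) * x ∈ padicMultiples p) :
    ∃ c : ℤ_[p], x = c := by
  obtain ⟨c, hc⟩ := hx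
  refine ⟨c, mul_left_cancel₀ natCast_ne_zero_padic ?_⟩
  rw [hc]
  push_cast
  ring

variable {σ τ κ κ' ι : Type*}

/-- The operator `▲` only relates coefficients whose multi-indices differ by powers of `p`. This
splits the nonzero multi-indices into orbits, each starting at an `m₀` not divisible by `p`. -/
theorem exists_pow_smul_eq {m : σ →₀ ℕ} (hm : m ≠ 0) :
    ∃ (k : ℕ) (m₀ : σ →₀ ℕ), (∀ m', m₀ ≠ p • m') ∧ m = p ^ k • m₀ := by
  induction h : m.degree using Nat.strong_induction_on generalizing m with
  | _ n ih =>
    by_cases hd : ∃ m', m = p • m'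
    · obtain ⟨m', rfl⟩ := hd
      have hm' : m' ≠ 0 := by
        rintro rfl
        simp at hm
      have h0 : m'.degree ≠ 0 := by rwa [ne_eq, Finsupp.degree_eq_zero_iff]
      have h1 : n = p * m'.degree := by rw [← h]; simp
      have h2 : 2 * m'.degree ≤ p * m'.degree := Nat.mul_le_mul_right _ hp.out.two_le
      obtain ⟨k, m₀, h3, h4⟩ := ih _ (by omega) hm' rfl
      exact ⟨k + 1, m₀, h3, by rw [pow_succ', mul_smul, ← h4]⟩
    · exact ⟨0, m, by simpa using hd, by simp⟩

theorem pow_smul_injective {m₀ : σ →₀ ℕ} (h : ∀ m', m₀ ≠ p • m') {k n : ℕ} (hkn : k < n)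
    (m' : σ →₀ ℕ) : p ^ k • m₀ ≠ p ^ n • m' := by
  intro h1
  obtain ⟨j, rfl⟩ := Nat.exists_eq_add_of_lt hkn
  refine h (p ^ j • m') ?_
  have h2 : p ^ k • m₀ = p ^ k • (p • p ^ j • m') := by
    rw [h1, smul_smul, smul_smul, pow_add, pow_add, pow_one]
    ring_nf
  ext i
  have h3 := DFunLike.congr_fun h2 i
  exact Nat.eq_of_mul_eq_mul_left (pow_pos hp.out.pos k) (by simpa using h3)

/-- The generating series of the coefficients of `g` at the multi-indices `p ^ k • m`. -/
def orbitSeries (g : MvPowerSeries σ ℚ_[p]) (m : σ →₀ ℕ) : PowerSeries ℚ_[p] :=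
  PowerSeries.mk fun k => coeff (p ^ k • m) g

theorem coeff_frobAct (a : PowerSeries ℤ_[p]) (g : MvPowerSeries σ ℚ_[p]) (m : σ →₀ ℕ) :
    coeff m (frobAct p a g) = ∑ n ∈ Finset.range (m.degree + 1),
      ((PowerSeries.coeff n a : ℤ_[p]) : ℚ_[p]) *
        coeff m (expand (p ^ n) (pow_ne_zero n hp.out.ne_zero) g) := rfl

/-- At the multi-index `0` the truncated sum keeps only `n = 0`. Thanks to this, `frobAct_mul` needs
no assumption on the constant term. -/
theorem coeff_zero_frobAct (a : PowerSeries ℤ_[p]) (g : MvPowerSeries σ ℚ_[p]) :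
    coeff 0 (frobAct p a g) = ((PowerSeries.coeff 0 a : ℤ_[p]) : ℚ_[p]) * coeff 0 g := by
  rw [coeff_frobAct]
  simp

theorem coeff_frobAct_of_le (a : PowerSeries ℤ_[p]) {g : MvPowerSeries σ ℚ_[p]}
    (hg : g.constantCoeff = 0) {m : σ →₀ ℕ} {N : ℕ} (hN : m.degree ≤ N) :
    coeff m (frobAct p a g) = ∑ n ∈ Finset.range (N + 1),
      ((PowerSeries.coeff n a : ℤ_[p]) : ℚ_[p]) *
        coeff m (expand (p ^ n) (pow_ne_zero n hp.out.ne_zero) g) := by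
  rw [coeff_frobAct]
  refine Finset.sum_subset (Finset.range_subset_range.2 (by omega)) fun n _ hn => ?_
  rw [coeff_expand_pow_eq_zero_of_degree_lt hp.out.one_lt _ hg (by simpa using hn), mul_zero]

theorem coeff_frobAct_pow_smul (a : PowerSeries ℤ_[p]) (g : MvPowerSeries σ ℚ_[p])
    {m : σ →₀ ℕ} (hm : ∀ m', m ≠ p • m') (k : ℕ) :
    coeff (p ^ k • m) (frobAct p a g) = ∑ n ∈ Finset.range (k + 1),
      ((PowerSeries.coeff n a : ℤ_[p]) : ℚ_[p]) * coeff (p ^ (k - n) • m) g := by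
  have h0 : m.degree ≠ 0 := by
    rw [ne_eq, Finsupp.degree_eq_zero_iff]
    rintro rfl
    exact hm 0 (by simp)
  have hk : k ≤ (p ^ k • m).degree := by
    have h1 : k < p ^ k := Nat.lt_pow_self hp.out.one_lt
    have h2 : p ^ k * 1 ≤ p ^ k * m.degree := Nat.mul_le_mul_left _ (Nat.one_le_iff_ne_zero.2 h0)
    have h3 : (p ^ k • m).degree = p ^ k * m.degree := by simp
    omega
  rw [coeff_frobAct]
  symm
  refine Finset.sum_subset_zero_on_sdiff (Finset.range_subset_range.2 (by omega)) ?_ ?_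
  · intro n hn
    rw [coeff_expand_eq_zero, mul_zero]
    exact pow_smul_injective hm (by simpa using (Finset.mem_sdiff.1 hn).2)
  · intro n hn
    have hn' : n ≤ k := Nat.lt_succ_iff.1 (Finset.mem_range.1 hn)
    have : p ^ k • m = p ^ n • (p ^ (k - n) • m) := by
      rw [smul_smul, ← pow_add, Nat.add_sub_cancel' hn']
    rw [this, coeff_expand_smul]

/-- Along one orbit `▲` is a shift, so the action becomes multiplication of power series in one
variable; the module laws and the invertibility arguments are read off from there. -/
theorem orbitSeries_frobAct (a : PowerSeries ℤ_[p]) (g : MvPowerSeries σ ℚ_[p])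
    {m : σ →₀ ℕ} (hm : ∀ m', m ≠ p • m') :
    orbitSeries (frobAct p a g) m = a.map (algebraMap ℤ_[p] ℚ_[p]) * orbitSeries g m := by
  ext k
  rw [orbitSeries, PowerSeries.coeff_mk, coeff_frobAct_pow_smul a g hm, PowerSeries.coeff_mul,
    Finset.Nat.sum_antidiagonal_eq_sum_range_succ_mk]
  simp [orbitSeries]

theorem eq_of_orbitSeries_eq {f g : MvPowerSeries σ ℚ_[p]} (h0 : coeff 0 f = coeff 0 g)
    (h : ∀ m : σ →₀ ℕ, (∀ m', m ≠ p • m') → orbitSeries f m = orbitSeries g m) : f = g := by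
  ext m
  by_cases hm : m = 0
  · rw [hm, h0]
  · obtain ⟨k, m₀, h1, rfl⟩ := exists_pow_smul_eq (p := p) hm
    simpa [orbitSeries] using congrArg (PowerSeries.coeff k) (h m₀ h1)

theorem orbitSeries_sum (s : Finset ι) (f : ι → MvPowerSeries σ ℚ_[p]) (m : σ →₀ ℕ) :
    orbitSeries (∑ i ∈ s, f i) m = ∑ i ∈ s, orbitSeries (f i) m := by
  ext k
  simp [orbitSeries]

theorem frobAct_mul (a b : PowerSeries ℤ_[p]) (g : MvPowerSeries σ ℚ_[p]) :
    frobAct p (a * b) g = frobAct p a (frobAct p b g) := by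
  refine eq_of_orbitSeries_eq (p := p) ?_ fun m hm => ?_
  · simp [coeff_zero_frobAct, mul_assoc]
  · rw [orbitSeries_frobAct _ _ hm, orbitSeries_frobAct _ _ hm, orbitSeries_frobAct _ _ hm,
      map_mul, mul_assoc]

theorem frobAct_sum (a : PowerSeries ℤ_[p]) (s : Finset ι) (g : ι → MvPowerSeries σ ℚ_[p]) :
    frobAct p a (∑ i ∈ s, g i) = ∑ i ∈ s, frobAct p a (g i) := by
  ext m
  simp only [coeff_frobAct, map_sum, Finset.mul_sum]
  exact Finset.sum_comm

theorem sum_frobAct (s : Finset ι) (a : ι → PowerSeries ℤ_[p]) (g : MvPowerSeries σ ℚ_[p]) :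
    frobAct p (∑ i ∈ s, a i) g = ∑ i ∈ s, frobAct p (a i) g := by
  ext m
  simp only [coeff_frobAct, map_sum, PadicInt.coe_sum, Finset.sum_mul]
  exact Finset.sum_comm

theorem frobAct_sub (a : PowerSeries ℤ_[p]) (g h : MvPowerSeries σ ℚ_[p]) :
    frobAct p a (g - h) = frobAct p a g - frobAct p a h := by
  ext m
  simp only [coeff_frobAct, map_sub, mul_sub, Finset.sum_sub_distrib]

theorem frobAct_C (c : ℤ_[p]) (g : MvPowerSeries σ ℚ_[p]) :
    frobAct p (PowerSeries.C c) g = (c : ℚ_[p]) • g := by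
  ext m
  rw [coeff_frobAct, Finset.sum_eq_single 0]
  · simp
  · intro n _ hn
    rw [PowerSeries.coeff_C, if_neg hn]
    simp
  · simp

/-- The action of a rectangular matrix over `ℤ_p[[▲]]` on a column of power series. -/
def frobTuple [Fintype ι] (u : Matrix κ ι (PowerSeries ℤ_[p])) (g : ι → MvPowerSeries σ ℚ_[p]) :
    κ → MvPowerSeries σ ℚ_[p] :=
  fun i => ∑ j, frobAct p (u i j) (g j)

/-- All the coefficients of the power series in the tuple lie in `p ℤ_p`. -/
def IsMultiple (g : κ → MvPowerSeries σ ℚ_[p]) : Prop :=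
  ∀ i m, coeff m (g i) ∈ padicMultiples p

section FrobTuple

variable [Fintype ι]

theorem frobTuple_mul [Fintype κ'] (u : Matrix κ κ' (PowerSeries ℤ_[p]))
    (w : Matrix κ' ι (PowerSeries ℤ_[p])) (g : ι → MvPowerSeries σ ℚ_[p]) :
    frobTuple (u * w) g = frobTuple u (frobTuple w g) := by
  funext i
  simp only [frobTuple, Matrix.mul_apply, sum_frobAct, frobAct_sum, frobAct_mul]
  exact Finset.sum_comm

theorem frobTuple_sub (u : Matrix κ ι (PowerSeries ℤ_[p])) (g h : ι → MvPowerSeries σ ℚ_[p]) :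
    frobTuple u (g - h) = frobTuple u g - frobTuple u h := by
  funext i
  simp [frobTuple, frobAct_sub]

theorem frobTuple_C (D : Matrix κ ι ℤ_[p]) (g : ι → MvPowerSeries σ ℚ_[p]) :
    frobTuple (D.map PowerSeries.C) g = matrixSMul (D.map (fun x : ℤ_[p] => (x : ℚ_[p]))) g := by
  funext i
  simp [frobTuple, matrixSMul, frobAct_C]

theorem IsMultiple.frobTuple {g : ι → MvPowerSeries σ ℚ_[p]} (hg : IsMultiple g)
    (u : Matrix κ ι (PowerSeries ℤ_[p])) : IsMultiple (frobTuple u g) := by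
  intro i m
  rw [_root_.frobTuple, map_sum]
  refine Submodule.sum_mem _ fun j _ => ?_
  rw [coeff_frobAct]
  refine Submodule.sum_mem _ fun n _ => coe_mul_mem_padicMultiples _ ?_
  by_cases h : ∃ m', m = p ^ n • m'
  · obtain ⟨m', rfl⟩ := h
    rw [coeff_expand_smul]
    exact hg j m'
  · rw [coeff_expand_eq_zero _ _ (by simpa using h)]
    exact Submodule.zero_mem _

theorem coeff_frobTuple_of_le (u : Matrix κ ι (PowerSeries ℤ_[p]))
    {g : ι → MvPowerSeries σ ℚ_[p]} (hg : ∀ j, (g j).constantCoeff = 0) (i : κ) {m : σ →₀ ℕ} {N : ℕ}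
    (hN : m.degree ≤ N) :
    coeff m (frobTuple u g i) = ∑ j, ∑ n ∈ Finset.range (N + 1),
      ((PowerSeries.coeff n (u i j) : ℤ_[p]) : ℚ_[p]) *
        coeff m (expand (p ^ n) (pow_ne_zero n hp.out.ne_zero) (g j)) := by
  rw [frobTuple, map_sum]
  exact Finset.sum_congr rfl fun j _ => coeff_frobAct_of_le _ (hg j) hN

end FrobTuple

/-! ### Denominators of a logarithm that has a type. -/

section Bounded

/-- The power series has the property that `p ^ k` times its coefficient at `p ^ k • m` is
integral. -/
def HasLogDenominators (f : MvPowerSeries σ ℚ_[p]) : Prop :=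
  ∀ m : σ →₀ ℕ, (∀ m', m ≠ p • m') → ∀ k : ℕ, ∃ c : ℤ_[p], (p : ℚ_[p]) ^ k * coeff (p ^ k • m) f = c

/-- Since `u ≡ p mod ▲`, the congruence `u L ≡ 0 mod p` expresses `p` times the coefficient at `p ^
k • m` through those at `p ^ j • m` with `j < k`, modulo `p ℤ_p`. Each step along the orbit thus
costs at most one factor `p`. -/
theorem hasLogDenominators_of_isMultiple [Fintype ι] [DecidableEq ι]
    {u : Matrix ι ι (PowerSeries ℤ_[p])}
    (hu : u.map PowerSeries.constantCoeff = (p : ℤ_[p]) • (1 : Matrix ι ι ℤ_[p]))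
    {L : ι → MvPowerSeries σ ℚ_[p]} (hL : IsMultiple (frobTuple u L)) (i : ι) :
    HasLogDenominators (L i) := by
  intro m hm k
  induction k using Nat.strong_induction_on generalizing i with
  | _ k ih =>
    have hu0 : ∀ j, PowerSeries.coeff 0 (u i j) = if i = j then (p : ℤ_[p]) else 0 := by
      intro j
      have := congrFun (congrFun hu i) j
      simpa [Matrix.one_apply] using this
    obtain ⟨c, hc⟩ := hL i (p ^ k • m)
    rw [frobTuple, map_sum] at hc
    simp only [coeff_frobAct_pow_smul _ _ hm, Finset.sum_range_succ', Finset.sum_add_distrib, hu0,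
      apply_ite (fun x : ℤ_[p] => (x : ℚ_[p])), ite_mul, PadicInt.coe_zero, zero_mul,
      Finset.sum_ite_eq, Finset.mem_univ, if_true, PadicInt.coe_natCast, Nat.sub_zero] at hc
    -- The coefficient at `p ^ (k - n - 1) • m` uses up `p ^ (k - n - 1)`; the remaining `p ^ (n +
    -- 1)` contains the required factor `p`.
    have hmem : ∑ j, ∑ n ∈ Finset.range k, ((PowerSeries.coeff (n + 1) (u i j) : ℤ_[p]) : ℚ_[p]) *
        coeff (p ^ (k - (n + 1)) • m) (L j) * (p : ℚ_[p]) ^ k ∈ padicMultiples p := by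
      refine Submodule.sum_mem _ fun j _ => Submodule.sum_mem _ fun n hn => ?_
      have hn' := Finset.mem_range.1 hn
      obtain ⟨x, hx⟩ := ih (k - (n + 1)) (by omega) j
      refine ⟨PowerSeries.coeff (n + 1) (u i j) * p ^ n * x, ?_⟩
      have hk : k = n + 1 + (k - (n + 1)) := by omega
      conv_lhs => rw [mul_assoc]; arg 2; arg 2; rw [hk, pow_add]
      push_cast
      rw [← hx]
      ring
    refine mem_subring_of_natCast_mul_mem ?_
    have h1 : (p : ℚ_[p]) * ((p : ℚ_[p]) ^ k * coeff (p ^ k • m) (L i)) =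
        ((p : ℤ_[p]) * (p ^ k * c) : ℤ_[p]) -
          ∑ j, ∑ n ∈ Finset.range k, ((PowerSeries.coeff (n + 1) (u i j) : ℤ_[p]) : ℚ_[p]) *
          coeff (p ^ (k - (n + 1)) • m) (L j) * (p : ℚ_[p]) ^ k := by
      simp only [← Finset.sum_mul]
      push_cast at hc ⊢
      linear_combination (p : ℚ_[p]) ^ k * hc
    rw [h1]
    exact Submodule.sub_mem _ ⟨_, rfl⟩ hmem

end Bounded

end Padic

/-! ### Honda's criteria: substitution, integrality and divisibility by the type. -/

section Padic

variable {p : ℕ} [hp : Fact p.Prime] {σ τ κ κ' ι : Type*}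

theorem MvPowerSeries.natCast_dvd_of_forall_coeff_dvd {A : Type*} [CommRing A] {n : ℕ}
    {f : MvPowerSeries σ A} (h : ∀ m, (n : A) ∣ coeff m f) : (n : MvPowerSeries σ A) ∣ f := by
  choose g hg using h
  let q : MvPowerSeries σ A := g
  refine ⟨q, ?_⟩
  ext m
  rw [← map_natCast (C (σ := σ) (R := A)), coeff_C_mul, hg m]
  rfl

/-- Modulo `p` the coefficients lie in the prime field, where Frobenius is the identity, so raising
to the power `p ^ n` only affects the variables. -/
theorem natCast_dvd_expand_pow_sub_pow (f : MvPowerSeries σ ℤ_[p]) (n : ℕ) :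
    (p : MvPowerSeries σ ℤ_[p]) ∣
      expand (p ^ n) (pow_ne_zero n hp.out.ne_zero) f - f ^ p ^ n := by
  refine natCast_dvd_of_forall_coeff_dvd fun m => ?_
  rw [← Ideal.mem_span_singleton, ← PadicInt.maximalIdeal_eq_span_p, ← PadicInt.ker_toZMod,
    RingHom.mem_ker, ← coeff_map, map_sub, map_pow, map_expand,
    ← map_iterateFrobenius_expand p hp.out.ne_zero, iterateFrobenius_eq_pow, ZMod.frobenius_zmod]
  have : (RingHom.id (ZMod p)) ^ n = RingHom.id (ZMod p) := one_pow n
  rw [this, map_id]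
  simp

theorem natCast_dvd_prod_pow_sub {A : Type*} [CommRing A] {n : ℕ} {a b : σ → A}
    (h : ∀ i, (n : A) ∣ a i - b i) (d : σ →₀ ℕ) :
    (n : A) ∣ (d.prod fun i k => a i ^ k) - d.prod fun i k => b i ^ k := by
  simp only [← Ideal.mem_span_singleton, ← Ideal.Quotient.eq] at h ⊢
  simp only [Finsupp.prod, map_prod, map_pow, h]

theorem prod_pow_smul {A : Type*} [CommRing A] (a : σ → A) (q : ℕ) (d : σ →₀ ℕ) :
    ((q • d).prod fun i k => a i ^ k) = (d.prod fun i k => a i ^ k) ^ q := by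
  rw [Finsupp.prod_of_support_subset _ Finsupp.support_smul _ (by simp), Finsupp.prod,
    ← Finset.prod_pow]
  exact Finset.prod_congr rfl fun i _ => by rw [Finsupp.smul_apply, smul_eq_mul, mul_comm, pow_mul]

theorem coeff_prod_map_pow {A B : Type*} [CommRing A] [CommRing B] (φ : A →+* B)
    (a : σ → MvPowerSeries τ A) (d : σ →₀ ℕ) (e : τ →₀ ℕ) :
    coeff e (d.prod fun i k => seriesMap φ a i ^ k) = φ (coeff e (d.prod fun i k => a i ^ k)) := by
  rw [← coeff_map]
  simp [Finsupp.prod, seriesMap]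

theorem Submodule.finsum_mem_of_forall_mem {R M : Type*} [Semiring R] [AddCommMonoid M]
    [Module R M] (S : Submodule R M) {f : ι → M} (h : ∀ i, f i ∈ S) : ∑ᶠ i, f i ∈ S :=
  finsum_induction (· ∈ S) S.zero_mem (fun _ _ => S.add_mem) h

section Subst

variable [Finite σ]

/-- If `a ≡ b mod p`, then their monomials at `p ^ k • m₀` agree modulo `p ^ (k + 1)`. The
denominator `p ^ k` of the coefficient there still leaves one factor `p`. -/
theorem HasLogDenominators.coeff_subst_sub_mem {f : MvPowerSeries σ ℚ_[p]}
    (hf : HasLogDenominators f) {a b : σ → MvPowerSeries τ ℤ_[p]}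
    (ha : ∀ i, (a i).constantCoeff = 0) (hb : ∀ i, (b i).constantCoeff = 0)
    (hab : ∀ i, (p : MvPowerSeries τ ℤ_[p]) ∣ a i - b i) (e : τ →₀ ℕ) :
    coeff e (f.subst (seriesMap (algebraMap ℤ_[p] ℚ_[p]) a)) -
      coeff e (f.subst (seriesMap (algebraMap ℤ_[p] ℚ_[p]) b)) ∈ padicMultiples p := by
  have hsa := hasSubst_of_constantCoeff_zero (constantCoeff_seriesMap (algebraMap ℤ_[p] ℚ_[p]) ha)
  have hsb := hasSubst_of_constantCoeff_zero (constantCoeff_seriesMap (algebraMap ℤ_[p] ℚ_[p]) hb)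
  rw [coeff_subst hsa, coeff_subst hsb,
    ← finsum_sub_distrib (coeff_subst_finite hsa f e) (coeff_subst_finite hsb f e)]
  refine Submodule.finsum_mem_of_forall_mem _ fun d => ?_
  rw [coeff_prod_map_pow, coeff_prod_map_pow, ← smul_sub, ← map_sub, ← map_sub, smul_eq_mul]
  by_cases hd : d = 0
  · simp [hd]
  obtain ⟨k, m₀, h1, rfl⟩ := exists_pow_smul_eq (p := p) hd
  obtain ⟨q, hq⟩ := dvd_sub_pow_of_dvd_sub (natCast_dvd_prod_pow_sub hab m₀) k
  obtain ⟨c, hc⟩ := hf m₀ h1 k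
  refine ⟨c * coeff e q, ?_⟩
  rw [prod_pow_smul, prod_pow_smul, hq, ← Nat.cast_pow, ← map_natCast (C (σ := τ) (R := ℤ_[p])),
    coeff_C_mul, PadicInt.algebraMap_apply]
  push_cast
  rw [← hc]
  ring

theorem coeff_subst_mem_padicMultiples {f : MvPowerSeries σ ℚ_[p]}
    (hf : ∀ m, coeff m f ∈ padicMultiples p) {a : σ → MvPowerSeries τ ℤ_[p]}
    (ha : ∀ i, (a i).constantCoeff = 0) (e : τ →₀ ℕ) :
    coeff e (f.subst (seriesMap (algebraMap ℤ_[p] ℚ_[p]) a)) ∈ padicMultiples p := by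
  rw [coeff_subst
    (hasSubst_of_constantCoeff_zero (constantCoeff_seriesMap (algebraMap ℤ_[p] ℚ_[p]) ha))]
  refine Submodule.finsum_mem_of_forall_mem _ fun d => ?_
  rw [coeff_prod_map_pow, smul_eq_mul, mul_comm]
  exact coe_mul_mem_padicMultiples _ (hf d)

theorem expand_subst_eq_subst_pow {A : Type*} [CommRing A] {q : ℕ} (hq : q ≠ 0)
    (f : MvPowerSeries σ A) {a : σ → MvPowerSeries τ A} (ha : ∀ i, (a i).constantCoeff = 0) :
    (expand q hq f).subst a = f.subst fun i => a i ^ q := by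
  have hs := hasSubst_of_constantCoeff_zero ha
  rw [expand, substAlgHom_apply, subst_comp_subst_apply (HasSubst.X_pow hq) hs]
  congr 1
  funext i
  rw [subst_pow hs, subst_X hs]

/-- If `u L ≡ 0 mod p`, then `u (L ∘ a) ≡ 0 mod p` for every tuple `a` over `ℤ_p`. -/
theorem isMultiple_frobTuple_seriesComp [Fintype ι] [DecidableEq ι]
    {u : Matrix ι ι (PowerSeries ℤ_[p])}
    (hu : u.map PowerSeries.constantCoeff = (p : ℤ_[p]) • (1 : Matrix ι ι ℤ_[p]))
    {L : ι → MvPowerSeries σ ℚ_[p]} (hL0 : ∀ i, (L i).constantCoeff = 0)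
    (hL : IsMultiple (frobTuple u L)) {a : σ → MvPowerSeries τ ℤ_[p]}
    (ha : ∀ i, (a i).constantCoeff = 0) :
    IsMultiple (frobTuple u (seriesComp L (seriesMap (algebraMap ℤ_[p] ℚ_[p]) a))) := by
  intro i e
  set a' := seriesMap (algebraMap ℤ_[p] ℚ_[p]) a with ha'
  have ha0 : ∀ i, (a' i).constantCoeff = 0 := constantCoeff_seriesMap _ ha
  have hs := hasSubst_of_constantCoeff_zero ha0
  have hq : ∀ n, p ^ n ≠ 0 := fun n => pow_ne_zero n hp.out.ne_zero
  set N := e.degree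
  -- A truncation of `u L` to a finite sum, with which substitution commutes; the discarded terms
  -- have order above `N = |e|` and do not reach the coefficient at `e`.
  let T : MvPowerSeries σ ℚ_[p] := ∑ j, ∑ n ∈ Finset.range (N + 1),
      ((PowerSeries.coeff n (u i j) : ℤ_[p]) : ℚ_[p]) • expand (p ^ n) (hq n) (L j)
  have hT : ((N + 1 : ℕ) : ℕ∞) ≤ (T - frobTuple u L i).order := by
    refine nat_le_order fun m hm => ?_
    rw [map_sub, coeff_frobTuple_of_le u hL0 i (Nat.lt_succ_iff.1 hm), sub_eq_zero]
    simp only [T, map_sum, coeff_smul]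
  have hT' : coeff e (T.subst a') = coeff e ((frobTuple u L i).subst a') := by
    refine coeff_eq_of_lt_order_sub ?_
    rw [← subst_sub hs]
    exact lt_of_lt_of_le (by exact_mod_cast Nat.lt_succ_self N)
      (hT.trans (order_le_order_subst _ ha0))
  have hTe : coeff e (T.subst a') = ∑ j, ∑ n ∈ Finset.range (N + 1),
      ((PowerSeries.coeff n (u i j) : ℤ_[p]) : ℚ_[p]) *
        coeff e ((L j).subst fun k => a' k ^ p ^ n) := by
    rw [← substAlgHom_apply hs]
    simp only [T, map_sum, AlgHom.map_smul_of_tower, coeff_smul]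
    simp only [substAlgHom_apply hs, expand_subst_eq_subst_pow _ _ ha0]
  rw [coeff_frobTuple_of_le u (constantCoeff_seriesComp L a' hL0 ha0) i le_rfl]
  have hmem := coeff_subst_mem_padicMultiples (fun m => hL i m) ha e
  rw [← ha', ← hT', hTe] at hmem
  -- Compare `▲ⁿ (L ∘ a) = L(a(X ^ pⁿ))` with `(▲ⁿ L) ∘ a = L(a ^ pⁿ)` term by term: the arguments
  -- are congruent modulo `p`, and the sum over the second kind is already known to lie in `p ℤ_p`.
  refine (Submodule.sub_mem_iff_left _ hmem).1 ?_
  rw [← Finset.sum_sub_distrib]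
  refine Submodule.sum_mem _ fun j _ => ?_
  rw [← Finset.sum_sub_distrib]
  refine Submodule.sum_mem _ fun n _ => ?_
  rw [← mul_sub]
  refine coe_mul_mem_padicMultiples _ ?_
  have h1 : expand (p ^ n) (hq n) (seriesComp L a' j) =
      (L j).subst (seriesMap (algebraMap ℤ_[p] ℚ_[p]) fun k => expand (p ^ n) (hq n) (a k)) := by
    rw [seriesComp, expand_subst _ _ hs]
    congr 1
    funext k
    simp only [ha', seriesMap, map_expand]
  have h2 : (fun k => a' k ^ p ^ n) = seriesMap (algebraMap ℤ_[p] ℚ_[p]) fun k => a k ^ p ^ n := by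
    funext k
    simp only [ha', seriesMap, map_pow]
  rw [h1, h2]
  refine (hasLogDenominators_of_isMultiple hu hL j).coeff_subst_sub_mem ?_ ?_ ?_ e
  · intro k
    rw [constantCoeff_expand, ha]
  · intro k
    rw [map_pow, ha, zero_pow (hq n)]
  · intro k
    exact natCast_dvd_expand_pow_sub_pow (a k) n

end Subst

/-- For `n > 0` the series `▲ⁿ g` starts in degree at least `p ^ n * |m| > |m|`. So a matrix `u ≡ p
mod ▲` multiplies lowest terms by `p`, which allows induction on the degree. -/
theorem coeff_frobAct_of_le_order (a : PowerSeries ℤ_[p]) {g : MvPowerSeries σ ℚ_[p]} {m : σ →₀ ℕ}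
    (hm : m ≠ 0) (hg : (m.degree : ℕ∞) ≤ g.order) :
    coeff m (frobAct p a g) = ((PowerSeries.coeff 0 a : ℤ_[p]) : ℚ_[p]) * coeff m g := by
  rw [coeff_frobAct, Finset.sum_eq_single 0]
  · simp
  · intro n _ hn
    rw [coeff_of_lt_order, mul_zero]
    rw [order_expand]
    have h1 : 2 * m.degree ≤ p ^ n * m.degree :=
      Nat.mul_le_mul_right _ (hp.out.two_le.trans (Nat.le_self_pow hn p))
    have h0 : m.degree ≠ 0 := by rwa [ne_eq, Finsupp.degree_eq_zero_iff]
    calc ((m.degree : ℕ) : ℕ∞) < ((p ^ n * m.degree : ℕ) : ℕ∞) := by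
          exact_mod_cast (by omega)
      _ = p ^ n • ((m.degree : ℕ) : ℕ∞) := by rw [nsmul_eq_mul]; push_cast; rfl
      _ ≤ p ^ n • g.order := by gcongr
  · simp

theorem coeff_frobTuple_of_le_order [Fintype ι] [DecidableEq ι] {u : Matrix ι ι (PowerSeries ℤ_[p])}
    (hu : u.map PowerSeries.constantCoeff = (p : ℤ_[p]) • (1 : Matrix ι ι ℤ_[p]))
    {g : ι → MvPowerSeries σ ℚ_[p]} {m : σ →₀ ℕ} (hm : m ≠ 0)
    (hg : ∀ j, (m.degree : ℕ∞) ≤ (g j).order) (i : ι) :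
    coeff m (frobTuple u g i) = p * coeff m (g i) := by
  have hu0 : ∀ j, PowerSeries.coeff 0 (u i j) = if i = j then (p : ℤ_[p]) else 0 := by
    intro j
    have := congrFun (congrFun hu i) j
    simpa [Matrix.one_apply] using this
  rw [frobTuple, map_sum]
  simp [coeff_frobAct_of_le_order _ hm (hg _), hu0, -PowerSeries.coeff_zero_eq_constantCoeff,
    apply_ite (fun x : ℤ_[p] => (x : ℚ_[p]))]

/-- If `L` is of type `u` and `u (L ∘ a) ≡ 0 mod p`, then `a` has coefficients in `ℤ_p`. -/
theorem IsNormalized.exists_coe_eq_coeff {d : ℕ} {u : Matrix (Fin d) (Fin d) (PowerSeries ℤ_[p])}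
    (hu : u.map PowerSeries.constantCoeff = (p : ℤ_[p]) • (1 : Matrix (Fin d) (Fin d) ℤ_[p]))
    {L : Fin d → MvPowerSeries (Fin d) ℚ_[p]} (hn : IsNormalized L)
    (hL : IsMultiple (frobTuple u L)) {a : Fin d → MvPowerSeries τ ℚ_[p]}
    (ha : ∀ i, (a i).constantCoeff = 0) (hLa : IsMultiple (frobTuple u (seriesComp L a)))
    (i : Fin d) (m : τ →₀ ℕ) : ∃ c : ℤ_[p], coeff m (a i) = c := by
  induction h : m.degree using Nat.strong_induction_on generalizing i m with
  | _ N ih =>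
    by_cases hm : m = 0
    · exact ⟨0, by rw [hm, coeff_zero_eq_constantCoeff_apply, ha, PadicInt.coe_zero]⟩
    have hN : N ≠ 0 := by rwa [← h, ne_eq, Finsupp.degree_eq_zero_iff]
    choose! c hc using fun m (hm : Finsupp.degree m < N) i => ih _ hm i m rfl
    -- The part of `a` of degree less than `N`, integral by the induction hypothesis.
    let b : Fin d → MvPowerSeries τ ℤ_[p] := fun i m => if m.degree < N then c m i else 0
    have hb : ∀ i m, coeff m (b i) = if m.degree < N then c m i else 0 := fun _ _ => rfl
    set b' := seriesMap (algebraMap ℤ_[p] ℚ_[p]) b with hb'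
    have hbc : ∀ i m, coeff m (b' i) = if m.degree < N then coeff m (a i) else 0 := by
      intro i m
      rw [hb', seriesMap, coeff_map, hb]
      split_ifs with hlt
      · rw [hc m hlt i]
        rfl
      · exact map_zero _
    have hab : ∀ i, (N : ℕ∞) ≤ (a i - b' i).order := by
      intro i
      refine nat_le_order fun m hm => ?_
      rw [map_sub, hbc, if_pos hm, sub_self]
    have hb0 : ∀ i, (b i).constantCoeff = 0 := by
      intro i
      have hlt : (0 : τ →₀ ℕ).degree < N := by simpa using Nat.pos_of_ne_zero hN
      rw [← coeff_zero_eq_constantCoeff_apply, hb, if_pos hlt]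
      have := hc 0 hlt i
      rw [coeff_zero_eq_constantCoeff_apply, ha] at this
      exact PadicInt.coe_eq_zero.1 this.symm
    have hb0' : ∀ i, (b' i).constantCoeff = 0 := constantCoeff_seriesMap _ hb0
    have hLb := isMultiple_frobTuple_seriesComp hu hn.constantCoeff_eq_zero hL hb0
    rw [← hb'] at hLb
    have hdiff := hn.le_order_comp_sub ha hb0' hab
    have hN1 : (N : ℕ∞) ≤ ((N + 1 : ℕ) : ℕ∞) := by exact_mod_cast N.le_succ
    have hord : ∀ j, (m.degree : ℕ∞) ≤ ((seriesComp L a - seriesComp L b') j).order := by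
      intro j
      rw [h]
      have := le_order_add (hN1.trans (hdiff j)) (hab j)
      rwa [sub_add_cancel] at this
    -- `L ∘ a - L ∘ b'` begins, in degree `N`, with the degree `N` part of `a`, and `u` acts on it
    -- as `p`. Both `u (L ∘ a)` and `u (L ∘ b')` are multiples of `p`, so the factor `p` cancels.
    have h1 := coeff_frobTuple_of_le_order hu hm hord i
    have h2 : coeff m ((seriesComp L a - seriesComp L b') i) = coeff m (a i) := by
      have h3 := coeff_eq_of_lt_order_sub (m := m)
        (lt_of_lt_of_le (by rw [h]; exact_mod_cast N.lt_succ_self) (hdiff i))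
      rw [Pi.sub_apply, h3, map_sub, hbc, if_neg (by omega), sub_zero]
    refine mem_subring_of_natCast_mul_mem ?_
    rw [← h2, ← h1, frobTuple_sub, Pi.sub_apply, map_sub]
    exact Submodule.sub_mem _ (hLa i m) (hLb i m)

theorem single_one_ne_prime_smul {j : σ} (m' : σ →₀ ℕ) : Finsupp.single j 1 ≠ p • m' := by
  intro h
  have h1 := DFunLike.congr_fun h j
  simp only [Finsupp.single_eq_same, Finsupp.smul_apply, smul_eq_mul] at h1
  exact hp.out.one_lt.ne' (Nat.eq_one_of_mul_eq_one_right h1.symm)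

theorem isUnit_of_isUnit_map_constantCoeff {A : Type*} [CommRing A] [Fintype ι] [DecidableEq ι]
    {M : Matrix ι ι (PowerSeries A)} (h : IsUnit (M.map PowerSeries.constantCoeff)) : IsUnit M := by
  rw [Matrix.isUnit_iff_isUnit_det, PowerSeries.isUnit_iff_constantCoeff, RingHom.map_det]
  exact (Matrix.isUnit_iff_isUnit_det _).1 h

/-- Only the monomials `x_j ^ (p ^ k)` are retained. When `L` is normalized, their coefficients form
a square matrix over `ℚ_p[[▲]]` with constant term `1`, so questions about `w L` become matrix
algebra. -/
theorem exists_map_mul_orbitSeries [Fintype ι] {L : ι → MvPowerSeries σ ℚ_[p]}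
    {w : Matrix κ ι (PowerSeries ℤ_[p])} (hw : IsMultiple (frobTuple w L)) :
    ∃ N : Matrix κ σ (PowerSeries ℤ_[p]),
      w.map (PowerSeries.map (algebraMap ℤ_[p] ℚ_[p])) *
          (Matrix.of fun i j => orbitSeries (L i) (Finsupp.single j 1)) =
        (p : PowerSeries ℚ_[p]) • N.map (PowerSeries.map (algebraMap ℤ_[p] ℚ_[p])) := by
  choose c hc using hw
  refine ⟨Matrix.of fun i j => PowerSeries.mk fun k => c i (p ^ k • Finsupp.single j 1), ?_⟩
  ext i j k
  have h1 : (w.map (PowerSeries.map (algebraMap ℤ_[p] ℚ_[p])) *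
      (Matrix.of fun i j => orbitSeries (L i) (Finsupp.single j 1))) i j =
        orbitSeries (frobTuple w L i) (Finsupp.single j 1) := by
    rw [frobTuple, orbitSeries_sum, Matrix.mul_apply]
    exact Finset.sum_congr rfl fun l _ =>
      (orbitSeries_frobAct (w i l) (L l) single_one_ne_prime_smul).symm
  rw [h1, orbitSeries, PowerSeries.coeff_mk, hc, Matrix.smul_apply, smul_eq_mul,
    ← map_natCast (PowerSeries.C (R := ℚ_[p])), PowerSeries.coeff_C_mul]
  simp

/-- If `L` is of type `u`, then every matrix `w` with `w L ≡ 0 mod p` is a left multiple of `u`. -/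
theorem IsNormalized.exists_eq_mul {d : ℕ} {u : Matrix (Fin d) (Fin d) (PowerSeries ℤ_[p])}
    (hu : u.map PowerSeries.constantCoeff = (p : ℤ_[p]) • (1 : Matrix (Fin d) (Fin d) ℤ_[p]))
    {L : Fin d → MvPowerSeries (Fin d) ℚ_[p]} (hn : IsNormalized L)
    (hL : IsMultiple (frobTuple u L)) {w : Matrix κ (Fin d) (PowerSeries ℤ_[p])}
    (hw : IsMultiple (frobTuple w L)) :
    ∃ t : Matrix κ (Fin d) (PowerSeries ℤ_[p]), w = t * u := by
  obtain ⟨N, hN⟩ := exists_map_mul_orbitSeries hL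
  obtain ⟨N', hN'⟩ := exists_map_mul_orbitSeries hw
  set φ : PowerSeries ℤ_[p] →+* PowerSeries ℚ_[p] := PowerSeries.map (algebraMap ℤ_[p] ℚ_[p])
    with hφdef
  have hφ : Function.Injective φ := by
    intro f g hfg
    ext n
    have := congrArg (PowerSeries.coeff n) hfg
    simp only [hφdef, PowerSeries.coeff_map] at this
    exact Subtype.coe_injective this
  have hφ0 : ∀ f, PowerSeries.constantCoeff (φ f) =
      ((PowerSeries.constantCoeff f : ℤ_[p]) : ℚ_[p]) := by
    intro f
    rw [← PowerSeries.coeff_zero_eq_constantCoeff_apply, hφdef, PowerSeries.coeff_map,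
      PowerSeries.coeff_zero_eq_constantCoeff_apply, PadicInt.algebraMap_apply]
  set Λ : Matrix (Fin d) (Fin d) (PowerSeries ℚ_[p]) :=
    Matrix.of fun i j => orbitSeries (L i) (Finsupp.single j 1) with hΛdef
  have hΛ : Λ.map PowerSeries.constantCoeff = 1 := by
    ext i j
    simp [hΛdef, orbitSeries, hn.coeff_single, Matrix.one_apply]
  -- Constant terms of `u Λ = p N` give `p = p N(0)`; hence `N` is invertible already over
  -- `ℤ_p[[▲]]`.
  have hN0 : N.map PowerSeries.constantCoeff = 1 := by
    have h1 := congrArg (fun M => M.map (PowerSeries.constantCoeff (R := ℚ_[p]))) hN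
    simp only [Matrix.map_mul, hΛ, mul_one] at h1
    ext i j
    have h2 := congrFun (congrFun h1 i) j
    have h3 := congrFun (congrFun hu i) j
    simp only [Matrix.map_apply, Matrix.smul_apply, smul_eq_mul] at h2 h3
    rw [hφ0, h3, map_mul, map_natCast, hφ0] at h2
    push_cast at h2
    have h6 := mul_left_cancel₀ natCast_ne_zero_padic h2
    exact Subtype.coe_injective h6.symm
  have hNu : IsUnit N := isUnit_of_isUnit_map_constantCoeff (by rw [hN0]; exact isUnit_one)
  have hΛu : IsUnit Λ := isUnit_of_isUnit_map_constantCoeff (by rw [hΛ]; exact isUnit_one)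
  have hNd := (Matrix.isUnit_iff_isUnit_det _).1 hNu
  have hΛd := (Matrix.isUnit_iff_isUnit_det _).1 hΛu
  refine ⟨N' * N⁻¹, ?_⟩
  -- `w Λ = p N' = N' N⁻¹ (p N) = N' N⁻¹ u Λ`, and `Λ` can be cancelled.
  have h1 : w.map φ * Λ = (N' * N⁻¹ * u).map φ * Λ := by
    have hNN : N' = N' * N⁻¹ * N := (Matrix.nonsing_inv_mul_cancel_right _ _ hNd).symm
    rw [hN', Matrix.map_mul (L := N' * N⁻¹), Matrix.mul_assoc, hN, Matrix.mul_smul,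
      ← Matrix.map_mul, ← hNN]
  have h2 := congrArg (· * Λ⁻¹) h1
  simp only [Matrix.mul_nonsing_inv_cancel_right _ _ hΛd] at h2
  exact Matrix.map_injective hφ h2

end Padic

/-! ### From all primes to integral coefficients. -/

theorem Rat.exists_intCast_eq_of_forall_padic {x : ℚ}
    (h : ∀ (p : ℕ) [Fact p.Prime], ∃ c : ℤ_[p], algebraMap ℚ ℚ_[p] x = c) : ∃ n : ℤ, (n : ℚ) = x := by
  refine ⟨x.num, Rat.den_eq_one_iff _ |>.1 ?_⟩
  by_contra hx
  obtain ⟨p, hp, hpx⟩ := Nat.exists_prime_and_dvd hx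
  have : Fact p.Prime := ⟨hp⟩
  obtain ⟨c, hc⟩ := h p
  have h1 : ‖(x : ℚ_[p])‖ ≤ 1 := by
    rw [← eq_ratCast (algebraMap ℚ ℚ_[p]), hc]
    exact c.2
  exact Rat.padicValuation_le_one_iff.1
    ((Padic.norm_rat_le_one_iff_padicValuation_le_one p).1 h1) hpx

theorem IsOfPType.isMultiple {p : ℕ} [Fact p.Prime] {d : ℕ}
    {u : Matrix (Fin d) (Fin d) (PowerSeries ℤ_[p])} {L : Fin d → MvPowerSeries (Fin d) ℚ}
    (h : IsOfPType p u L) : IsMultiple (frobTuple u (seriesMap (algebraMap ℚ ℚ_[p]) L)) := h.2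

theorem seriesMap_intCast_padicInt (p : ℕ) [Fact p.Prime] {κ σ : Type*}
    (a : κ → MvPowerSeries σ ℤ) :
    seriesMap (algebraMap ℚ ℚ_[p]) (seriesMap (Int.castRingHom ℚ) a) =
      seriesMap (algebraMap ℤ_[p] ℚ_[p]) (seriesMap (Int.castRingHom ℤ_[p]) a) := by
  rw [seriesMap_seriesMap, seriesMap_seriesMap]
  congr 1

/-- If `L` is of `p`-type `u_p` for every `p`, then `L⁻¹ ∘ M` has integral coefficients as soon as
`u_p M ≡ 0 mod p` for every `p`. -/
theorem IsNormalized.exists_integral_seriesComp_eq {d : ℕ} {τ : Type*}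
    {L : Fin d → MvPowerSeries (Fin d) ℚ} (hn : IsNormalized L)
    {u : ∀ (p : ℕ) [Fact p.Prime], Matrix (Fin d) (Fin d) (PowerSeries ℤ_[p])}
    (hL : ∀ (p : ℕ) [Fact p.Prime], IsOfPType p (u p) L)
    {M : Fin d → MvPowerSeries τ ℚ} (hM0 : ∀ i, (M i).constantCoeff = 0)
    (hM : ∀ (p : ℕ) [Fact p.Prime],
      IsMultiple (frobTuple (u p) (seriesMap (algebraMap ℚ ℚ_[p]) M))) :
    ∃ a : Fin d → MvPowerSeries τ ℤ, (∀ i, (a i).constantCoeff = 0) ∧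
      seriesComp L (seriesMap (Int.castRingHom ℚ) a) = M := by
  obtain ⟨b, hb0, hb⟩ := hn.exists_seriesComp_eq hM0
  have hint : ∀ i m, ∃ n : ℤ, (n : ℚ) = coeff m (b i) := by
    intro i m
    refine Rat.exists_intCast_eq_of_forall_padic fun p _ => ?_
    have h := (hn.map (algebraMap ℚ ℚ_[p])).exists_coe_eq_coeff (hL p).1 (hL p).isMultiple
      (constantCoeff_seriesMap (algebraMap ℚ ℚ_[p]) hb0)
      (by rw [← seriesMap_seriesComp _ _ _ hb0, hb]; exact hM p) i m
    simpa [seriesMap] using h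
  choose c hc using hint
  let a : Fin d → MvPowerSeries τ ℤ := fun i m => c i m
  have ha : seriesMap (Int.castRingHom ℚ) a = b := by
    funext i
    ext m
    rw [seriesMap, coeff_map, ← hc]
    rfl
  refine ⟨a, fun i => ?_, by rw [ha, hb]⟩
  have h1 := hc i 0
  rw [coeff_zero_eq_constantCoeff_apply, hb0] at h1
  exact_mod_cast h1

/-! ### Block matrices and the consequences of the block condition. -/

section Blocks

variable {e r : ℕ} (he : e ≤ r) {A : Type*} [CommRing A]

theorem eq_topIdx_or_botIdx (i : Fin r) : (∃ a, i = topIdx he a) ∨ ∃ b, i = botIdx he b := by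
  by_cases h : (i : ℕ) < e
  · exact Or.inl ⟨⟨i, h⟩, rfl⟩
  · exact Or.inr ⟨⟨i - e, by omega⟩, Fin.ext (by simp [botIdx]; omega)⟩

theorem sum_topIdx_add_sum_botIdx {M : Type*} [AddCommMonoid M] (f : Fin r → M) :
    ∑ i, f i = ∑ a, f (topIdx he a) + ∑ b, f (botIdx he b) := by
  have h : e + (r - e) = r := by omega
  rw [← Equiv.sum_comp (finCongr h) f, Fin.sum_univ_add]
  rfl

theorem submatrix_mul_eq_add {κ κ' ι ι' : Type*} (M : Matrix κ (Fin r) A) (N : Matrix (Fin r) ι A)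
    (f : κ' → κ) (g : ι' → ι) :
    (M * N).submatrix f g =
      M.submatrix f (topIdx he) * N.submatrix (topIdx he) g +
        M.submatrix f (botIdx he) * N.submatrix (botIdx he) g := by
  ext i j
  simp only [Matrix.submatrix_apply, Matrix.mul_apply, Matrix.add_apply]
  exact sum_topIdx_add_sum_botIdx he _

theorem mul_stdIncl {κ : Type*} (M : Matrix κ (Fin r) A) :
    M * stdIncl A r e = M.submatrix id (topIdx he) := by
  ext i j
  rw [Matrix.mul_apply, Finset.sum_eq_single (topIdx he j)]
  · simp [stdIncl, topIdx]
  · intro k _ hk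
    have : ¬ (k : ℕ) = j := fun h => hk (Fin.ext h)
    simp [stdIncl, this]
  · simp

theorem stdIncl_map {B : Type*} [CommRing B] (φ : A →+* B) :
    (stdIncl A r e).map φ = stdIncl B r e := by
  ext i j
  simp [stdIncl, apply_ite φ]

/-- The lower left block of `v` is a left multiple of the upper left block if `v` intertwines
constant matrices that satisfy the block condition with other matrices. -/
theorem exists_submatrix_eq_mul [IsDomain A] {π : A} (hπ : π ≠ 0)
    {v : Matrix (Fin r) (Fin r) (PowerSeries A)}
    (hv : v.map PowerSeries.constantCoeff = π • (1 : Matrix (Fin r) (Fin r) A))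
    {m : ℕ} (D : Fin m → Matrix (Fin r) (Fin r) A)
    (hD : ∀ i, (D i).submatrix id (topIdx he) = 0)
    (W : Fin m → Matrix (Fin r) (Fin r) (PowerSeries A))
    (hW : ∀ i, v * (D i).map PowerSeries.C = W i * v)
    (Chat : Fin m → Matrix (Fin (r - e)) (Fin e) A)
    (Ctil : Fin m → Matrix (Fin (r - e)) (Fin (r - e)) A)
    (hC : IsUnit (∑ i, (Chat i * (D i).submatrix (topIdx he) (botIdx he) +
      Ctil i * (D i).submatrix (botIdx he) (botIdx he)))) :
    ∃ Y : Matrix (Fin r) (Fin e) (PowerSeries A),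
      v.submatrix id (topIdx he) = Y * v.submatrix (topIdx he) (topIdx he) := by
  -- Modulo `▲` the relation `v D = W v` reads `π D = π W(0)`.
  have hW0 : ∀ i, (W i).map PowerSeries.constantCoeff = D i := by
    intro i
    have h1 := congrArg (fun M => M.map (PowerSeries.constantCoeff (R := A))) (hW i)
    simp only [Matrix.map_mul, hv] at h1
    have h2 : ((D i).map PowerSeries.C).map (PowerSeries.constantCoeff (R := A)) = D i := by
      ext a b
      simp
    rw [h2, Matrix.smul_mul, Matrix.mul_smul, one_mul, mul_one] at h1
    ext a b
    have h3 := congrFun (congrFun h1 a) b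
    simp only [Matrix.smul_apply, smul_eq_mul] at h3
    exact (mul_left_cancel₀ hπ h3).symm
  -- The first `e` columns of `v D = W v` vanish because those of `D` do.
  have hzero : ∀ {κ : Type} (f : κ → Fin r) (i : Fin m),
      (W i).submatrix f (topIdx he) * v.submatrix (topIdx he) (topIdx he) +
        (W i).submatrix f (botIdx he) * v.submatrix (botIdx he) (topIdx he) = 0 := by
    intro κ f i
    rw [← submatrix_mul_eq_add, ← hW]
    ext1 a b
    rw [Matrix.submatrix_apply, Matrix.mul_apply, Matrix.zero_apply]
    refine Finset.sum_eq_zero fun c _ => ?_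
    have := congrFun (congrFun (hD i) c) b
    simp only [Matrix.submatrix_apply, id_eq, Matrix.zero_apply] at this
    rw [Matrix.map_apply, this, map_zero, mul_zero]
  -- The combination of the hypothesis, formed with `Wᵢ` in place of `Dᵢ`. Its constant term is the
  -- given unit, so `S` is invertible and `T v₁₁ + S v₂₁ = 0` can be solved for `v₂₁`.
  set S : Matrix (Fin (r - e)) (Fin (r - e)) (PowerSeries A) :=
    ∑ i, ((Chat i).map PowerSeries.C * (W i).submatrix (topIdx he) (botIdx he) +
      (Ctil i).map PowerSeries.C * (W i).submatrix (botIdx he) (botIdx he)) with hS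
  have hSu : IsUnit S := by
    refine isUnit_of_isUnit_map_constantCoeff ?_
    convert hC using 1
    have hmap : ∀ M : Matrix (Fin (r - e)) (Fin (r - e)) (PowerSeries A),
      M.map PowerSeries.constantCoeff = (PowerSeries.constantCoeff (R := A)).mapMatrix M :=
      fun _ => rfl
    rw [hS, hmap, map_sum]
    refine Finset.sum_congr rfl fun i _ => ?_
    rw [map_add, ← hmap, ← hmap, Matrix.map_mul, Matrix.map_mul, ← Matrix.submatrix_map,
      ← Matrix.submatrix_map, hW0, Matrix.map_map, Matrix.map_map]
    congr 2
  have hSd := (Matrix.isUnit_iff_isUnit_det _).1 hSu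
  set T : Matrix (Fin (r - e)) (Fin e) (PowerSeries A) :=
    ∑ i, ((Chat i).map PowerSeries.C * (W i).submatrix (topIdx he) (topIdx he) +
      (Ctil i).map PowerSeries.C * (W i).submatrix (botIdx he) (topIdx he)) with hT
  have hTS : T * v.submatrix (topIdx he) (topIdx he) +
      S * v.submatrix (botIdx he) (topIdx he) = 0 := by
    rw [hT, hS, Matrix.sum_mul, Matrix.sum_mul, ← Finset.sum_add_distrib]
    refine Finset.sum_eq_zero fun i _ => ?_
    have h1 := congrArg ((Chat i).map PowerSeries.C * ·) (hzero (topIdx he) i)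
    have h2 := congrArg ((Ctil i).map PowerSeries.C * ·) (hzero (botIdx he) i)
    simp only [Matrix.mul_add, Matrix.mul_zero, ← Matrix.mul_assoc] at h1 h2
    rw [Matrix.add_mul, Matrix.add_mul, add_add_add_comm, h1, h2, add_zero]
  have hbot : v.submatrix (botIdx he) (topIdx he) =
      (S⁻¹ * -T) * v.submatrix (topIdx he) (topIdx he) := by
    rw [Matrix.mul_assoc, Matrix.neg_mul, neg_eq_of_add_eq_zero_right hTS, ← Matrix.mul_assoc,
      Matrix.nonsing_inv_mul _ hSd, Matrix.one_mul]
  have hrow : ∀ i, ∃ y : Fin e → PowerSeries A, ∀ j,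
      v i (topIdx he j) = ∑ k, y k * v (topIdx he k) (topIdx he j) := by
    intro i
    rcases eq_topIdx_or_botIdx he i with ⟨a, rfl⟩ | ⟨b, rfl⟩
    · exact ⟨Pi.single a 1, fun j => by simp [Pi.single_apply]⟩
    · refine ⟨(S⁻¹ * -T) b, fun j => ?_⟩
      have := congrFun (congrFun hbot b) j
      rwa [Matrix.mul_apply] at this
  choose Y hY using hrow
  exact ⟨Y, by ext1 i j; exact hY i j⟩

/-- A column killed by matrices that satisfy the block condition has vanishing lower part. -/
theorem eq_zero_of_matrixSMul_eq_zero {B σ : Type*} [CommRing B] (φ : A →+* B) {m : ℕ}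
    (D : Fin m → Matrix (Fin r) (Fin r) A) (hD : ∀ i, (D i).submatrix id (topIdx he) = 0)
    (Chat : Fin m → Matrix (Fin (r - e)) (Fin e) A)
    (Ctil : Fin m → Matrix (Fin (r - e)) (Fin (r - e)) A)
    (hC : IsUnit (∑ i, (Chat i * (D i).submatrix (topIdx he) (botIdx he) +
      Ctil i * (D i).submatrix (botIdx he) (botIdx he))))
    {g : Fin r → MvPowerSeries σ B} (hg : ∀ i, matrixSMul ((D i).map φ) g = 0) (b : Fin (r - e)) :
    g (botIdx he b) = 0 := by
  -- With its first `e` columns zero, `D` sees only the lower part of `g`.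
  have hsub : ∀ {κ : Type} (f : κ → Fin r) (i : Fin m),
      matrixSMul (((D i).submatrix f (botIdx he)).map φ) (g ∘ botIdx he) = 0 := by
    intro κ f i
    funext k
    have h1 := congrFun (hg i) (f k)
    rw [matrixSMul, sum_topIdx_add_sum_botIdx he, Finset.sum_eq_zero, zero_add] at h1
    · exact h1
    · intro a _
      have := congrFun (congrFun (hD i) (f k)) a
      simp only [Matrix.submatrix_apply, id_eq, Matrix.zero_apply] at this
      rw [Matrix.map_apply, this, map_zero, zero_smul]
  set S := ∑ i, (Chat i * (D i).submatrix (topIdx he) (botIdx he) +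
      Ctil i * (D i).submatrix (botIdx he) (botIdx he)) with hS
  have hSg : matrixSMul (S.map φ) (g ∘ botIdx he) = 0 := by
    have hmap : ∀ M : Matrix (Fin (r - e)) (Fin (r - e)) A, M.map φ = φ.mapMatrix M := fun _ => rfl
    have hsum : ∀ (s : Finset (Fin m)) (N : Fin m → Matrix (Fin (r - e)) (Fin (r - e)) B),
        (∀ i, matrixSMul (N i) (g ∘ botIdx he) = 0) →
          matrixSMul (∑ i ∈ s, N i) (g ∘ botIdx he) = 0 := by
      intro s N hN
      classical
      induction s using Finset.induction_on with
      | empty => exact zero_matrixSMul _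
      | insert a s ha ih => rw [Finset.sum_insert ha, add_matrixSMul, hN, ih, add_zero]
    have hz : ∀ {κ : Type} [Fintype κ] (N : Matrix (Fin (r - e)) κ B),
        matrixSMul N (0 : κ → MvPowerSeries σ B) = 0 := by
      intro κ _ N
      funext i
      simp [matrixSMul]
    rw [hS, hmap, map_sum]
    refine hsum _ _ fun i => ?_
    rw [map_add, ← hmap, ← hmap, Matrix.map_mul, Matrix.map_mul, add_matrixSMul, mul_matrixSMul,
      mul_matrixSMul, hsub, hsub, hz, hz, add_zero]
  obtain ⟨S', hS'⟩ := hC.exists_left_inv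
  have h1 : matrixSMul ((S' * S).map φ) (g ∘ botIdx he) = 0 := by
    rw [Matrix.map_mul, mul_matrixSMul, hSg]
    funext i
    simp [matrixSMul]
  rw [hS', Matrix.map_one φ (map_zero φ) (map_one φ), one_matrixSMul] at h1
  exact congrFun h1 b

end Blocks

theorem Matrix.map_intCast_map {κ ι A B : Type*} [CommRing A] [CommRing B] (M : Matrix κ ι ℤ)
    (φ : A →+* B) : (M.map (Int.castRingHom A)).map φ = M.map (Int.castRingHom B) := by
  ext i j
  simp

theorem Matrix.map_intCast_mul {κ ι μ A : Type*} [CommRing A] [Fintype ι] (M : Matrix κ ι ℤ)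
    (N : Matrix ι μ ℤ) :
    (M * N).map (Int.castRingHom A) = M.map (Int.castRingHom A) * N.map (Int.castRingHom A) :=
  Matrix.map_mul

namespace Matrix.GeneralLinearGroup

variable {r : ℕ} (Q : GeneralLinearGroup (Fin r) ℤ) (A : Type*) [CommRing A]

theorem inv_map_mul_map :
    (↑Q⁻¹ : Matrix (Fin r) (Fin r) ℤ).map (Int.castRingHom A) *
      (↑Q : Matrix (Fin r) (Fin r) ℤ).map (Int.castRingHom A) = 1 := by
  rw [← Matrix.map_intCast_mul, ← Units.val_mul, inv_mul_cancel, Units.val_one]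
  exact Matrix.map_one _ (map_zero _) (map_one _)

theorem map_mul_inv_map :
    (↑Q : Matrix (Fin r) (Fin r) ℤ).map (Int.castRingHom A) *
      (↑Q⁻¹ : Matrix (Fin r) (Fin r) ℤ).map (Int.castRingHom A) = 1 := by
  rw [← Matrix.map_intCast_mul, ← Units.val_mul, mul_inv_cancel, Units.val_one]
  exact Matrix.map_one _ (map_zero _) (map_one _)

end Matrix.GeneralLinearGroup

/-! ### The group action in terms of the logarithm and the types. -/

open FormalGroupLaw

/-- `L ∘ s` is again a homomorphism to the additive law, hence a matrix multiple of `L`; comparing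
linear terms identifies the matrix. -/
theorem FormalGroupLaw.Hom.seriesComp_logarithm {r : ℕ} {Φ : FormalGroupLaw ℤ r}
    {L : Hom (Φ.map (Int.castRingHom ℚ)) (additive ℚ r)} (hL : IsLogarithm L) (s : Hom Φ Φ) :
    seriesComp L.toSeries (seriesMap (Int.castRingHom ℚ) s.toSeries) =
      matrixSMul (s.linearCoeff.map (Int.castRingHom ℚ)) L.toSeries := by
  have h := Hom.toSeries_eq_matrixSMul hL (L.comp (s.map (Int.castRingHom ℚ)))
  have h1 : (L.comp (s.map (Int.castRingHom ℚ))).linearCoeff =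
      s.linearCoeff.map (Int.castRingHom ℚ) := by
    ext i j
    refine ((Hom.isNormalized hL).coeff_single_seriesComp
      (s.map (Int.castRingHom ℚ)).constantCoeff_eq_zero i j).trans ?_
    simp [Hom.map, seriesMap, Hom.linearCoeff]
  rwa [h1] at h

/-- This gives every group element an integral matrix in the star set, so that the vanishing of
columns can be used to prove invariance over `ℤ`. -/
theorem linearCoeff_sub_one_mem_starSet (p : ℕ) [Fact p.Prime] {G : Type*} [Group G] {r : ℕ}
    {Φ : FormalGroupLaw ℤ r} (ρ : G →* Φ.Aut)
    {L : Hom (Φ.map (Int.castRingHom ℚ)) (additive ℚ r)} (hL : IsLogarithm L) (s : G) :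
    ((ρ s : Hom Φ Φ).linearCoeff - 1).map (Int.castRingHom ℤ_[p]) ∈ starSet p ρ L.toSeries := by
  refine ⟨s, ?_⟩
  have h := congrArg (seriesMap (algebraMap ℚ ℚ_[p])) (Hom.seriesComp_logarithm hL (ρ s : Hom Φ Φ))
  rw [seriesMap_seriesComp _ _ _ (constantCoeff_seriesMap _ (ρ s : Hom Φ Φ).constantCoeff_eq_zero),
    seriesMap_matrixSMul, Matrix.map_intCast_map, seriesMap_seriesMap] at h
  have h1 : (algebraMap ℚ ℚ_[p]).comp (Int.castRingHom ℚ) = Int.castRingHom ℚ_[p] :=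
    Subsingleton.elim _ _
  rw [h1] at h
  rw [h]
  congr 1
  ext i j
  simp [Matrix.one_apply]

section Local

variable {p : ℕ} [hp : Fact p.Prime] {G : Type*} [Group G] {r e : ℕ} {Φ : FormalGroupLaw ℤ r}
  {ρ : G →* Φ.Aut} {L : Hom (Φ.map (Int.castRingHom ℚ)) (additive ℚ r)}

/-- The series of type `v` intertwines the matrices in the star set with other matrices. -/
theorem exists_mul_eq_mul_of_mem_starSet (hL : IsLogarithm L)
    {v : Matrix (Fin r) (Fin r) (PowerSeries ℤ_[p])} (hv : IsOfPType p v L.toSeries)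
    {D : Matrix (Fin r) (Fin r) ℤ_[p]} (hD : D ∈ starSet p ρ L.toSeries) :
    ∃ w : Matrix (Fin r) (Fin r) (PowerSeries ℤ_[p]), v * D.map PowerSeries.C = w * v := by
  obtain ⟨s, hs⟩ := hD
  have hn := (Hom.isNormalized hL).map (algebraMap ℚ ℚ_[p])
  have hσ := (ρ s : Hom Φ Φ).constantCoeff_eq_zero
  -- The automorphism is integral, so `v (D + 1) L = v (L ∘ σ) ≡ 0 mod p`, and `v (D + 1)` must be a
  -- left multiple of `v`.
  have h1 := isMultiple_frobTuple_seriesComp hv.1 hn.constantCoeff_eq_zero hv.isMultiple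
    (constantCoeff_seriesMap (Int.castRingHom ℤ_[p]) hσ)
  rw [← seriesMap_intCast_padicInt, seriesMap_seriesMap,
    Subsingleton.elim ((algebraMap ℚ ℚ_[p]).comp (Int.castRingHom ℚ)) (Int.castRingHom ℚ_[p]), hs,
    ← frobTuple_C, ← frobTuple_mul] at h1
  obtain ⟨w, hw⟩ := hn.exists_eq_mul hv.1 hv.isMultiple h1
  refine ⟨w - 1, ?_⟩
  have h2 : (D + 1).map (PowerSeries.C (R := ℤ_[p])) = D.map PowerSeries.C + 1 := by
    change (PowerSeries.C (R := ℤ_[p])).mapMatrix (D + 1) = _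
    rw [map_add, map_one]
    rfl
  rw [h2, mul_add, mul_one] at hw
  rw [sub_mul, one_mul, ← hw, add_sub_cancel_right]

variable (he : e ≤ r) (Q : Matrix.GeneralLinearGroup (Fin r) ℤ)

/-- The first columns of `Q⁻¹ v Q` are a left multiple of the upper left block. -/
theorem exists_mul_stdIncl_eq (hL : IsLogarithm L)
    {v : Matrix (Fin r) (Fin r) (PowerSeries ℤ_[p])} (hv : IsOfPType p v L.toSeries)
    (hQ : BlockCondition he (starSet p ρ L.toSeries)
      (Matrix.GeneralLinearGroup.map (Int.castRingHom ℤ_[p]) Q)) :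
    ∃ Y : Matrix (Fin r) (Fin e) (PowerSeries ℤ_[p]),
      v * ((↑Q : Matrix (Fin r) (Fin r) ℤ) * stdIncl ℤ r e).map
          (Int.castRingHom (PowerSeries ℤ_[p])) =
        Y * conjTopLeft he Q v := by
  obtain ⟨h0, m, D, Chat, Ctil, hD, hC⟩ := hQ
  set P := (↑Q : Matrix (Fin r) (Fin r) ℤ).map (Int.castRingHom (PowerSeries ℤ_[p])) with hP
  set P' := (↑Q⁻¹ : Matrix (Fin r) (Fin r) ℤ).map (Int.castRingHom (PowerSeries ℤ_[p])) with hP'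
  have hPP' : P * P' = 1 := Q.map_mul_inv_map _
  choose W hW using fun i => exists_mul_eq_mul_of_mem_starSet hL hv (hD i)
  have hv' : (P' * v * P).map PowerSeries.constantCoeff =
      (p : ℤ_[p]) • (1 : Matrix (Fin r) (Fin r) ℤ_[p]) := by
    rw [Matrix.map_mul, Matrix.map_mul, hv.1, hP, hP', Matrix.map_intCast_map,
      Matrix.map_intCast_map, Matrix.mul_smul, mul_one, Matrix.smul_mul, Q.inv_map_mul_map]
  have hconj : ∀ i, (P' * v * P) * ((↑(Matrix.GeneralLinearGroup.map (Int.castRingHom ℤ_[p]) Q)⁻¹ :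
      Matrix (Fin r) (Fin r) ℤ_[p]) * D i *
      (↑(Matrix.GeneralLinearGroup.map (Int.castRingHom ℤ_[p]) Q) :
        Matrix (Fin r) (Fin r) ℤ_[p])).map PowerSeries.C = (P' * W i * P) * (P' * v * P) := by
    intro i
    have e1 : (↑(Matrix.GeneralLinearGroup.map (Int.castRingHom ℤ_[p]) Q) :
        Matrix (Fin r) (Fin r) ℤ_[p]).map PowerSeries.C = P :=
      Matrix.map_intCast_map _ _
    have e2 : (↑(Matrix.GeneralLinearGroup.map (Int.castRingHom ℤ_[p]) Q)⁻¹ :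
        Matrix (Fin r) (Fin r) ℤ_[p]).map PowerSeries.C = P' := by
      rw [← map_inv]
      exact Matrix.map_intCast_map _ _
    rw [Matrix.map_mul, Matrix.map_mul, e1, e2]
    calc P' * v * P * (P' * (D i).map PowerSeries.C * P)
        = P' * v * (P * P') * (D i).map PowerSeries.C * P := by simp only [mul_assoc]
      _ = P' * (v * (D i).map PowerSeries.C) * P := by rw [hPP']; simp only [mul_assoc, mul_one]
      _ = P' * W i * (P * P') * v * P := by rw [hW, hPP']; simp only [mul_assoc, mul_one]
      _ = _ := by simp only [mul_assoc]
  obtain ⟨Y, hY⟩ := exists_submatrix_eq_mul he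
    (show (p : ℤ_[p]) ≠ 0 by exact_mod_cast hp.out.ne_zero) hv' _ (fun i => h0 _ (hD i)) _ hconj
    Chat Ctil hC
  -- With `u = conjTopLeft he Q v`, one has `v P I = P (P' v P) I = P Y u`.
  refine ⟨P * Y, ?_⟩
  have hvP : v * P = P * (P' * v * P) := by
    rw [← mul_assoc, ← mul_assoc, hPP', one_mul]
  rw [Matrix.map_intCast_mul, ← hP, stdIncl_map, Matrix.mul_assoc, conjTopLeft, ← hP, ← hP', ← hY,
    ← mul_stdIncl he, ← Matrix.mul_assoc, hvP, Matrix.mul_assoc]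

/-- From `v Q I = Y u`. Applied to the logarithm of `F`, this makes `f` integral. -/
theorem isMultiple_frobTuple_of_conjTopLeft (hL : IsLogarithm L)
    {v : Matrix (Fin r) (Fin r) (PowerSeries ℤ_[p])} (hv : IsOfPType p v L.toSeries)
    (hQ : BlockCondition he (starSet p ρ L.toSeries)
      (Matrix.GeneralLinearGroup.map (Int.castRingHom ℤ_[p]) Q)) {τ : Type*}
    {g : Fin e → MvPowerSeries τ ℚ}
    (hg : IsMultiple (frobTuple (conjTopLeft he Q v) (seriesMap (algebraMap ℚ ℚ_[p]) g))) :
    IsMultiple (frobTuple v (seriesMap (algebraMap ℚ ℚ_[p]) (matrixSMul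
      (((↑Q : Matrix (Fin r) (Fin r) ℤ) * stdIncl ℤ r e).map (Int.castRingHom ℚ)) g))) := by
  obtain ⟨Y, hY⟩ := exists_mul_stdIncl_eq he Q hL hv hQ
  have h1 : (((↑Q : Matrix (Fin r) (Fin r) ℤ) * stdIncl ℤ r e).map (Int.castRingHom ℚ)).map
      (algebraMap ℚ ℚ_[p]) = (((↑Q : Matrix (Fin r) (Fin r) ℤ) * stdIncl ℤ r e).map
        (Int.castRingHom ℤ_[p])).map (fun x : ℤ_[p] => (x : ℚ_[p])) := by
    ext i j
    simp only [Matrix.map_apply]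
    simp
  rw [seriesMap_matrixSMul, h1, ← frobTuple_C, Matrix.map_intCast_map, ← frobTuple_mul, hY,
    frobTuple_mul]
  exact hg.frobTuple Y

/-- Multiplying by `Q⁻¹` and keeping the first `e` rows turns `v Q I` into `u`, so this direction
needs no block condition. It makes the factoring map `g` integral. -/
theorem isMultiple_frobTuple_conjTopLeft {v : Matrix (Fin r) (Fin r) (PowerSeries ℤ_[p])} {τ : Type*}
    {g : Fin e → MvPowerSeries τ ℚ}
    (hg : IsMultiple (frobTuple v (seriesMap (algebraMap ℚ ℚ_[p]) (matrixSMul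
      (((↑Q : Matrix (Fin r) (Fin r) ℤ) * stdIncl ℤ r e).map (Int.castRingHom ℚ)) g)))) :
    IsMultiple (frobTuple (conjTopLeft he Q v) (seriesMap (algebraMap ℚ ℚ_[p]) g)) := by
  have h1 : (((↑Q : Matrix (Fin r) (Fin r) ℤ) * stdIncl ℤ r e).map (Int.castRingHom ℚ)).map
      (algebraMap ℚ ℚ_[p]) = (((↑Q : Matrix (Fin r) (Fin r) ℤ) * stdIncl ℤ r e).map
        (Int.castRingHom ℤ_[p])).map (fun x : ℤ_[p] => (x : ℚ_[p])) := by
    ext i j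
    simp only [Matrix.map_apply]
    simp
  rw [seriesMap_matrixSMul, h1, ← frobTuple_C, Matrix.map_intCast_map, ← frobTuple_mul] at hg
  have h2 := hg.frobTuple ((↑Q⁻¹ : Matrix (Fin r) (Fin r) ℤ).map
    (Int.castRingHom (PowerSeries ℤ_[p])))
  rw [← frobTuple_mul, Matrix.map_intCast_mul, stdIncl_map, ← Matrix.mul_assoc, ← Matrix.mul_assoc,
    mul_stdIncl he] at h2
  exact fun i m => h2 (topIdx he i) m

end Local

section Fixed

variable {p : ℕ} [hp : Fact p.Prime] {G : Type*} [Group G] {r e : ℕ} {Φ : FormalGroupLaw ℤ r}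
  {ρ : G →* Φ.Aut} {L : Hom (Φ.map (Int.castRingHom ℚ)) (additive ℚ r)}

/-- Applying `L` to `σ ∘ f = f` gives `(D + 1)(L ∘ f) = L ∘ f`. -/
theorem FormalGroupLaw.IsFixedPair.matrixSMul_eq_zero {D : Matrix (Fin r) (Fin r) ℤ_[p]}
    (hD : D ∈ starSet p ρ L.toSeries) {d : ℕ} {F : FormalGroupLaw ℤ d} {f : Hom F Φ}
    (hf : IsFixedPair ρ f) :
    matrixSMul (D.map (algebraMap ℤ_[p] ℚ_[p])) (seriesMap (algebraMap ℚ ℚ_[p])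
      (seriesComp L.toSeries (seriesMap (Int.castRingHom ℚ) f.toSeries))) = 0 := by
  obtain ⟨s, hs⟩ := hD
  have hσ := (ρ s : Hom Φ Φ).constantCoeff_eq_zero
  have hf0 := f.constantCoeff_eq_zero
  have hfix : seriesComp (ρ s : Hom Φ Φ).toSeries f.toSeries = f.toSeries :=
    congrArg Hom.toSeries (hf s)
  have hfp := constantCoeff_seriesMap (Int.castRingHom ℚ_[p]) hf0
  have h1 := congrArg (fun g => seriesComp g (seriesMap (Int.castRingHom ℚ_[p]) f.toSeries)) hs
  rw [seriesComp_assoc _ _ _ (constantCoeff_seriesMap _ hσ) hfp, ← seriesMap_seriesComp _ _ _ hf0,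
    hfix, seriesComp_matrixSMul _ _ hfp] at h1
  rw [seriesMap_seriesComp _ _ _ (constantCoeff_seriesMap _ hf0), seriesMap_seriesMap,
    Subsingleton.elim ((algebraMap ℚ ℚ_[p]).comp (Int.castRingHom ℚ)) (Int.castRingHom ℚ_[p])]
  have h2 : (D + 1).map (fun x : ℤ_[p] => (x : ℚ_[p])) = D.map (algebraMap ℤ_[p] ℚ_[p]) + 1 := by
    change (algebraMap ℤ_[p] ℚ_[p]).mapMatrix (D + 1) = _
    rw [map_add, map_one]
    rfl
  rw [h2, add_matrixSMul, one_matrixSMul] at h1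
  exact right_eq_add.1 h1

variable (he : e ≤ r) (Q : Matrix.GeneralLinearGroup (Fin r) ℤ)

/-- The conjugates `Q⁻¹ D Q` kill `Q⁻¹ μ`. The vanishing is obtained over `ℚ_p` but concerns
rational coefficients, so a single prime suffices. -/
theorem FormalGroupLaw.IsFixedPair.matrixSMul_inv_botIdx_eq_zero
    (hQ : BlockCondition he (starSet p ρ L.toSeries)
      (Matrix.GeneralLinearGroup.map (Int.castRingHom ℤ_[p]) Q))
    {d : ℕ} {F : FormalGroupLaw ℤ d} {f : Hom F Φ} (hf : IsFixedPair ρ f) (b : Fin (r - e)) :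
    matrixSMul ((↑Q⁻¹ : Matrix (Fin r) (Fin r) ℤ).map (Int.castRingHom ℚ))
      (seriesComp L.toSeries (seriesMap (Int.castRingHom ℚ) f.toSeries)) (botIdx he b) = 0 := by
  obtain ⟨h0, m, D, Chat, Ctil, hD, hC⟩ := hQ
  set μ := seriesComp L.toSeries (seriesMap (Int.castRingHom ℚ) f.toSeries)
  have hzero := eq_zero_of_matrixSMul_eq_zero he (algebraMap ℤ_[p] ℚ_[p]) _
    (fun i => h0 _ (hD i)) Chat Ctil hC
    (g := seriesMap (algebraMap ℚ ℚ_[p])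
      (matrixSMul ((↑Q⁻¹ : Matrix (Fin r) (Fin r) ℤ).map (Int.castRingHom ℚ)) μ))
    (fun i => by
      have e1 : (↑(Matrix.GeneralLinearGroup.map (Int.castRingHom ℤ_[p]) Q) :
          Matrix (Fin r) (Fin r) ℤ_[p]).map (algebraMap ℤ_[p] ℚ_[p]) =
          (↑Q : Matrix (Fin r) (Fin r) ℤ).map (Int.castRingHom ℚ_[p]) :=
        Matrix.map_intCast_map _ _
      have e2 : (↑(Matrix.GeneralLinearGroup.map (Int.castRingHom ℤ_[p]) Q)⁻¹ :
          Matrix (Fin r) (Fin r) ℤ_[p]).map (algebraMap ℤ_[p] ℚ_[p]) =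
          (↑Q⁻¹ : Matrix (Fin r) (Fin r) ℤ).map (Int.castRingHom ℚ_[p]) := by
        rw [← map_inv]
        exact Matrix.map_intCast_map _ _
      rw [Matrix.map_mul, Matrix.map_mul, e1, e2, seriesMap_matrixSMul, Matrix.map_intCast_map,
        ← mul_matrixSMul, Matrix.mul_assoc, Q.map_mul_inv_map, Matrix.mul_one, mul_matrixSMul,
        hf.matrixSMul_eq_zero (hD i)]
      funext j
      simp [matrixSMul]) b
  ext m
  have := congrArg (coeff m) hzero
  simpa only [seriesMap, coeff_map, map_zero, _root_.map_eq_zero] using this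

/-- The matrices in the star set kill the first `e` columns of `Q`. -/
theorem mul_mul_stdIncl_eq_zero {E : Matrix (Fin r) (Fin r) ℤ}
    (hE : E.map (Int.castRingHom ℤ_[p]) ∈ starSet p ρ L.toSeries)
    (hQ : BlockCondition he (starSet p ρ L.toSeries)
      (Matrix.GeneralLinearGroup.map (Int.castRingHom ℤ_[p]) Q)) :
    E * ((↑Q : Matrix (Fin r) (Fin r) ℤ) * stdIncl ℤ r e) = 0 := by
  have h0 := hQ.1 _ hE
  have e1 : (↑(Matrix.GeneralLinearGroup.map (Int.castRingHom ℤ_[p]) Q)⁻¹ :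
      Matrix (Fin r) (Fin r) ℤ_[p]) =
      (↑Q⁻¹ : Matrix (Fin r) (Fin r) ℤ).map (Int.castRingHom ℤ_[p]) := by
    rw [← map_inv]
    rfl
  have e2 : (↑(Matrix.GeneralLinearGroup.map (Int.castRingHom ℤ_[p]) Q) :
      Matrix (Fin r) (Fin r) ℤ_[p]) =
      (↑Q : Matrix (Fin r) (Fin r) ℤ).map (Int.castRingHom ℤ_[p]) := rfl
  have h1 : ((↑Q⁻¹ : Matrix (Fin r) (Fin r) ℤ) * E * (↑Q : Matrix (Fin r) (Fin r) ℤ) *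
      stdIncl ℤ r e).map (Int.castRingHom ℤ_[p]) = 0 := by
    rw [Matrix.map_intCast_mul, Matrix.map_intCast_mul, Matrix.map_intCast_mul, stdIncl_map,
      mul_stdIncl he, ← e1, ← e2]
    exact h0
  have h2 : (↑Q⁻¹ : Matrix (Fin r) (Fin r) ℤ) * E * (↑Q : Matrix (Fin r) (Fin r) ℤ) *
      stdIncl ℤ r e = 0 := by
    ext i j
    have := congrFun (congrFun h1 i) j
    simpa using this
  have h3 := congrArg ((↑Q : Matrix (Fin r) (Fin r) ℤ) * ·) h2
  have h4 : (↑Q : Matrix (Fin r) (Fin r) ℤ) * (↑Q⁻¹ : Matrix (Fin r) (Fin r) ℤ) = 1 := by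
    rw [← Units.val_mul, mul_inv_cancel, Units.val_one]
  simpa only [← Matrix.mul_assoc, h4, Matrix.one_mul, Matrix.mul_zero] using h3

end Fixed

/-- A column of power series is determined by the upper part of its product with `Q⁻¹` if the
lower part of this product vanishes. -/
theorem matrixSMul_mul_stdIncl_eq {r e : ℕ} (he : e ≤ r)
    (Q : Matrix.GeneralLinearGroup (Fin r) ℤ) {τ A : Type*} [CommRing A]
    {μ : Fin r → MvPowerSeries τ A}
    (hμ : ∀ b, matrixSMul ((↑Q⁻¹ : Matrix (Fin r) (Fin r) ℤ).map (Int.castRingHom A)) μ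
      (botIdx he b) = 0) :
    matrixSMul (((↑Q : Matrix (Fin r) (Fin r) ℤ) * stdIncl ℤ r e).map (Int.castRingHom A))
      (matrixSMul (((↑Q⁻¹ : Matrix (Fin r) (Fin r) ℤ).map (Int.castRingHom A)).submatrix
        (topIdx he) id) μ) = μ := by
  set ν := matrixSMul ((↑Q⁻¹ : Matrix (Fin r) (Fin r) ℤ).map (Int.castRingHom A)) μ with hν
  have h1 : matrixSMul ((↑Q : Matrix (Fin r) (Fin r) ℤ).map (Int.castRingHom A)) ν = μ := by
    rw [hν, ← mul_matrixSMul, Q.map_mul_inv_map, one_matrixSMul]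
  rw [Matrix.map_intCast_mul, stdIncl_map, mul_stdIncl he]
  conv_rhs => rw [← h1]
  funext i
  rw [matrixSMul, matrixSMul, sum_topIdx_add_sum_botIdx he,
    Finset.sum_eq_zero (s := Finset.univ (α := Fin (r - e))) fun b _ => by rw [hμ, smul_zero],
    _root_.add_zero]
  rfl

theorem matrixSMul_mul_stdIncl_injective {r e : ℕ} (he : e ≤ r)
    (Q : Matrix.GeneralLinearGroup (Fin r) ℤ) {τ A : Type*} [CommRing A]
    {g h : Fin e → MvPowerSeries τ A}
    (hgh : matrixSMul (((↑Q : Matrix (Fin r) (Fin r) ℤ) * stdIncl ℤ r e).map (Int.castRingHom A)) g =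
      matrixSMul (((↑Q : Matrix (Fin r) (Fin r) ℤ) * stdIncl ℤ r e).map (Int.castRingHom A)) h) :
    g = h := by
  have h1 := congrArg
    (matrixSMul ((↑Q⁻¹ : Matrix (Fin r) (Fin r) ℤ).map (Int.castRingHom A))) hgh
  rw [← mul_matrixSMul, ← mul_matrixSMul, Matrix.map_intCast_mul, ← Matrix.mul_assoc,
    Q.inv_map_mul_map, stdIncl_map, mul_stdIncl he] at h1
  funext i
  have h2 := congrFun h1 (topIdx he i)
  have hinj : ∀ j, topIdx he i = topIdx he j ↔ i = j := fun j =>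
    ⟨fun hij => Fin.castLE_injective he hij, fun hij => hij ▸ rfl⟩
  simpa [matrixSMul, Matrix.one_apply, hinj, ite_smul] using h2

end

/-! ### Existence and universality of the fixed pair. -/

theorem mainTheorem10 {G : Type*} [Group G] {r e : ℕ} (he : e ≤ r)
    (Φ : FormalGroupLaw ℤ r) (ρ : G →* Φ.Aut)
    (L : FormalGroupLaw.Hom (Φ.map (Int.castRingHom ℚ)) (FormalGroupLaw.additive ℚ r))
    (hL : FormalGroupLaw.IsLogarithm L)
    (v : ∀ (p : ℕ) [Fact p.Prime], Matrix (Fin r) (Fin r) (PowerSeries ℤ_[p]))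
    (hv : ∀ (p : ℕ) [Fact p.Prime], IsOfPType p (v p) L.toSeries)
    (Q : Matrix.GeneralLinearGroup (Fin r) ℤ)
    (hQ : ∀ (p : ℕ) [Fact p.Prime], BlockCondition he (starSet p ρ L.toSeries)
      (Matrix.GeneralLinearGroup.map (Int.castRingHom ℤ_[p]) Q))
    (F : FormalGroupLaw ℤ e)
    (l : FormalGroupLaw.Hom (F.map (Int.castRingHom ℚ)) (FormalGroupLaw.additive ℚ e))
    (hl : FormalGroupLaw.IsLogarithm l)
    (hF : ∀ (p : ℕ) [Fact p.Prime], IsOfPType p (conjTopLeft he Q (v p)) l.toSeries) :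
    ∃ f : FormalGroupLaw.Hom F Φ,
      f.linearCoeff = (↑Q : Matrix (Fin r) (Fin r) ℤ) * stdIncl ℤ r e ∧
        FormalGroupLaw.IsUniversalFixedPair ρ f := by
  have hint := (Int.castRingHom ℚ).injective_int
  have hn := FormalGroupLaw.Hom.isNormalized hL
  have hnl := FormalGroupLaw.Hom.isNormalized hl
  set B : Matrix (Fin r) (Fin e) ℤ := (↑Q : Matrix (Fin r) (Fin r) ℤ) * stdIncl ℤ r e with hB
  let M := l.smulAdditive (B.map (Int.castRingHom ℚ))
  obtain ⟨a, ha0, ha⟩ := hn.exists_integral_seriesComp_eq hv M.constantCoeff_eq_zero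
    fun p _ => isMultiple_frobTuple_of_conjTopLeft he Q hL (hv p) (hQ p) (hF p).isMultiple
  obtain ⟨f, rfl⟩ := FormalGroupLaw.Hom.exists_toSeries_eq hint hL M ha0 ha
  have hf : seriesComp L.toSeries (seriesMap (Int.castRingHom ℚ) f.toSeries) =
    matrixSMul (B.map (Int.castRingHom ℚ)) l.toSeries := ha
  have hfq := constantCoeff_seriesMap (Int.castRingHom ℚ) ha0
  have hcomp : ∀ {d : ℕ} {F' : FormalGroupLaw ℤ d} (g : FormalGroupLaw.Hom F' F),
      seriesComp L.toSeries (seriesMap (Int.castRingHom ℚ) (f.comp g).toSeries) =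
        matrixSMul (B.map (Int.castRingHom ℚ))
          (seriesComp l.toSeries (seriesMap (Int.castRingHom ℚ) g.toSeries)) := by
    intro d F' g
    have hg0 := constantCoeff_seriesMap (Int.castRingHom ℚ) g.constantCoeff_eq_zero
    rw [← seriesComp_matrixSMul _ _ hg0, ← hf, seriesComp_assoc _ _ _ hfq hg0,
      ← seriesMap_seriesComp _ _ _ g.constantCoeff_eq_zero]
    rfl
  have hext : ∀ {d : ℕ} {F' : FormalGroupLaw ℤ d} (g h : FormalGroupLaw.Hom F' Φ),
      seriesComp L.toSeries (seriesMap (Int.castRingHom ℚ) g.toSeries) =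
        seriesComp L.toSeries (seriesMap (Int.castRingHom ℚ) h.toSeries) → g = h :=
    fun g h hgh => FormalGroupLaw.Hom.ext (seriesMap_injective hint (hn.seriesComp_injective
      (constantCoeff_seriesMap _ g.constantCoeff_eq_zero)
      (constantCoeff_seriesMap _ h.constantCoeff_eq_zero) hgh))
  refine ⟨f, ?_, ?_, ?_⟩
  · ext i j
    have h1 := hn.coeff_single_seriesComp hfq i j
    rw [hf, coeff_matrixSMul] at h1
    simp only [hnl.coeff_single, mul_ite, mul_one, mul_zero, Finset.sum_ite_eq', Finset.mem_univ,
      if_true, seriesMap, MvPowerSeries.coeff_map] at h1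
    exact (hint h1).symm
  · intro s
    refine hext _ _ ?_
    -- The identity to be proved is between integral matrices, so any one prime will do.
    have hE := mul_mul_stdIncl_eq_zero (p := 2) he Q
      (linearCoeff_sub_one_mem_starSet 2 ρ hL s) (hQ 2)
    rw [← hB, Matrix.sub_mul, Matrix.one_mul, sub_eq_zero] at hE
    have h1 : seriesComp L.toSeries (seriesMap (Int.castRingHom ℚ)
        ((ρ s : FormalGroupLaw.Hom Φ Φ).comp f).toSeries) =
        seriesComp (seriesComp L.toSeries (seriesMap (Int.castRingHom ℚ) (ρ s : FormalGroupLaw.Hom Φ Φ).toSeries))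
          (seriesMap (Int.castRingHom ℚ) f.toSeries) := by
      rw [seriesComp_assoc _ _ _
        (constantCoeff_seriesMap _ (ρ s : FormalGroupLaw.Hom Φ Φ).constantCoeff_eq_zero) hfq,
        ← seriesMap_seriesComp _ _ _ ha0]
      rfl
    rw [h1, FormalGroupLaw.Hom.seriesComp_logarithm hL, seriesComp_matrixSMul _ _ hfq, hf, ← mul_matrixSMul,
      ← Matrix.map_intCast_mul, hE]
  · intro d F' f' hf'
    let μ := L.comp (f'.map (Int.castRingHom ℚ))
    have hμ : μ.toSeries = seriesComp L.toSeries (seriesMap (Int.castRingHom ℚ) f'.toSeries) := rfl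
    -- The first `e` entries of `Q⁻¹ μ`; the others vanish because `f'` is fixed, so `μ = B μ₁`.
    let μ₁ := μ.smulAdditive
      (((↑Q⁻¹ : Matrix (Fin r) (Fin r) ℤ).map (Int.castRingHom ℚ)).submatrix (topIdx he) id)
    have hμ₁ : matrixSMul (B.map (Int.castRingHom ℚ)) μ₁.toSeries = μ.toSeries :=
      matrixSMul_mul_stdIncl_eq he Q
        (hf'.matrixSMul_inv_botIdx_eq_zero (p := 2) he Q (hQ 2))
    obtain ⟨b, hb0, hb⟩ := hnl.exists_integral_seriesComp_eq hF μ₁.constantCoeff_eq_zero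
      fun p _ => isMultiple_frobTuple_conjTopLeft he Q (by
        rw [← hB, hμ₁, hμ, seriesMap_seriesComp _ _ _
          (constantCoeff_seriesMap _ f'.constantCoeff_eq_zero), seriesMap_intCast_padicInt]
        exact isMultiple_frobTuple_seriesComp (hv p).1
          (constantCoeff_seriesMap _ hn.constantCoeff_eq_zero) (hv p).isMultiple
          (constantCoeff_seriesMap _ f'.constantCoeff_eq_zero))
    obtain ⟨g, rfl⟩ := FormalGroupLaw.Hom.exists_toSeries_eq hint hl μ₁ hb0 hb
    have hfg : f' = f.comp g := hext _ _ (by rw [hcomp, hb, hμ₁, hμ])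
    refine ⟨g, hfg, fun g' hg' => ?_⟩
    refine FormalGroupLaw.Hom.ext (seriesMap_injective hint (hnl.seriesComp_injective
      (constantCoeff_seriesMap _ g'.constantCoeff_eq_zero) (constantCoeff_seriesMap _ hb0)
      (matrixSMul_mul_stdIncl_injective he Q ?_)))
    rw [← hB, ← hcomp, ← hcomp, ← hg', ← hfg]
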